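/- Let $d\ge 0$, $L>0$, $\beta\in[0,1)$, $p\in(\tfrac12,1)$, $c_2>0$, $M\ge 0$ and $w_0,w_*\in\mathbb{R}^d$. There is a constant $K_{13}>0$, depending only on $d,L,\beta,p,c_2,M,w_0,w_*$, for which the following holds. Let $\rho$ be a probability density on a measurable set $\mathcal{Z}\subset\mathbb{R}^N$, and let $\ell:\mathcal{Z}\times\mathbb{R}^d\to[0,\infty)$ be measurable in its first argument and such that, for every $z\in\mathcal{Z}$, the function $\ell(z,\cdot)$ is convex and differentiable with $\|\nabla\ell(z,u)-\nabla\ell(z,v)\|\le L\|u-v\|$ for all $u,v\in\mathbb{R}^d$ (gradients are taken in the second argument, and $\|\cdot\|$ is the Euclidean norm). Assume that $\ell(\cdot,w)$ and $\nabla\ell(\cdot,w)$ are integrable with respect to $\rho\,dz$ for every $w$, put $F(w)=\int_{\mathcal{Z}}\ell(z,w)\,\rho(z)\,dz$ and $F_*=\inf_{w}F(w)$, and assume that $F(w_*)=F_*$ and $\sup_{z\in\mathcal{Z}}\ell(z,w_*)\le M$. Let $(\alpha_t)_{t\ge0}$ be a nonincreasing sequence of step sizes such that, for some $c_1>0$,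 $c_1t^{-p}\le\alpha_t\le c_2t^{-p}$ for all $t\ge1$. Let $(Z_t)$ be i.i.d. random vectors with density $\rho$, and let $w_t$ be the stochastic heavy ball iterates $$w_1=w_0,\qquad w_{t+1}=w_t-\alpha_t\nabla\ell(Z_t,w_t)+\beta\,(w_t-w_{t-1})\quad(t\ge1).$$ Then for all integers $T>1$ and $T_0\in(1,T]$ and all $\delta\in(0,1)$, $$\mathbb{P}\left(F(w_{T+1})-F_*\le K_{13}\Big(\log\frac{3T}{\delta}\Big)^2\max\Big\{\frac1{\sum_{t=T_0}^{T}\alpha_t},\;T_0^{\,1-2p},\;\beta^{T_0}\Big\}\right)\ge1-\delta .$$ -/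

import Mathlib

open MeasureTheory ProbabilityTheory

namespace SHB

noncomputable section

/-- `ℝⁿ` with the Euclidean norm. -/
abbrev Vec (n : ℕ) : Type := EuclideanSpace ℝ (Fin n)

/-- The measure `ρ dz` on `𝒵 ⊆ ℝᴺ`. -/
def sampleLaw {N : ℕ} (𝒵 : Set (Vec N)) (ρ : Vec N → ℝ) : Measure (Vec N) :=
  (volume.restrict 𝒵).withDensity (fun z => ENNReal.ofReal (ρ z))

/-- `ρ` is a probability density on the measurable set `𝒵`. -/
structure IsDensityOn {N : ℕ} (𝒵 : Set (Vec N)) (ρ : Vec N → ℝ) : Prop where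
  measurableSet : MeasurableSet 𝒵
  measurable : Measurable ρ
  nonneg : ∀ z ∈ 𝒵, 0 ≤ ρ z
  total : ∫⁻ z in 𝒵, ENNReal.ofReal (ρ z) = 1

/-- The objective `F(w) = 𝔼_ρ[ℓ(Z, w)]`. -/
def risk {N d : ℕ} (𝒵 : Set (Vec N)) (ρ : Vec N → ℝ) (ℓ : Vec N → Vec d → ℝ) (w : Vec d) : ℝ :=
  ∫ z, ℓ z w ∂(sampleLaw 𝒵 ρ)

/-- The optimal value `F_* = inf_w F(w)`. -/
def optValue {N d : ℕ} (𝒵 : Set (Vec N)) (ρ : Vec N → ℝ) (ℓ : Vec N → Vec d → ℝ) : ℝ :=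
  ⨅ w, risk 𝒵 ρ ℓ w

/-- The assumptions on the loss: for every `z ∈ 𝒵` the function `ℓ(z, ·)` is nonnegative, convex and
differentiable with `L`-Lipschitz gradient; `F` and `𝔼_ρ[∇ℓ(Z, w)]` are well defined; `F` is bounded
below and `wstar` is a global minimizer of `F`. -/
structure LossAssumption {N d : ℕ} (L : ℝ) (𝒵 : Set (Vec N)) (ρ : Vec N → ℝ)
    (ℓ : Vec N → Vec d → ℝ) (wstar : Vec d) : Prop where
  measurable : ∀ w, Measurable (fun z => ℓ z w)
  nonneg : ∀ z ∈ 𝒵, ∀ w, 0 ≤ ℓ z w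
  convex : ∀ z ∈ 𝒵, ConvexOn ℝ Set.univ (ℓ z)
  differentiable : ∀ z ∈ 𝒵, Differentiable ℝ (ℓ z)
  lipschitz_gradient : ∀ z ∈ 𝒵, ∀ u v, ‖gradient (ℓ z) u - gradient (ℓ z) v‖ ≤ L * ‖u - v‖
  integrable : ∀ w, Integrable (fun z => ℓ z w) (sampleLaw 𝒵 ρ)
  integrable_gradient : ∀ w, Integrable (fun z => gradient (ℓ z) w) (sampleLaw 𝒵 ρ)
  bddBelow : BddBelow (Set.range (risk 𝒵 ρ ℓ))
  minimizer : risk 𝒵 ρ ℓ wstar = optValue 𝒵 ρ ℓ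

/-- Nonincreasing step sizes with `c₁ t^{-p} ≤ α_t ≤ c₂ t^{-p}` for all `t ≥ 1`. -/
structure StepSize (p c₁ c₂ : ℝ) (α : ℕ → ℝ) : Prop where
  antitone : Antitone α
  lower : ∀ t : ℕ, 1 ≤ t → c₁ * (t : ℝ) ^ (-p) ≤ α t
  upper : ∀ t : ℕ, 1 ≤ t → α t ≤ c₂ * (t : ℝ) ^ (-p)

/-- The samples `Z_t` are independent and each has the distribution `ρ dz` on `𝒵`. -/
structure IsSample {N : ℕ} {Ω : Type*} [MeasurableSpace Ω] (P : Measure Ω)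
    (𝒵 : Set (Vec N)) (ρ : Vec N → ℝ) (Z : ℕ → Ω → Vec N) : Prop where
  measurable : ∀ t, Measurable (Z t)
  indep : iIndepFun Z P
  law : ∀ t, P.map (Z t) = sampleLaw 𝒵 ρ

/-- The stochastic heavy ball iterates along the sample sequence `z`: `w_1 = w_0` and
`w_{t+1} = w_t - α_t ∇ℓ(z_t, w_t) + β (w_t - w_{t-1})` for `t ≥ 1`. -/
def heavyBall {N d : ℕ} (ℓ : Vec N → Vec d → ℝ) (α : ℕ → ℝ) (β : ℝ) (w₀ : Vec d)
    (z : ℕ → Vec N) : ℕ → Vec d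
  | 0 => w₀
  | 1 => w₀
  | t + 2 =>
      heavyBall ℓ α β w₀ z (t + 1)
        - α (t + 1) • gradient (ℓ (z (t + 1))) (heavyBall ℓ α β w₀ z (t + 1))
        + β • (heavyBall ℓ α β w₀ z (t + 1) - heavyBall ℓ α β w₀ z t)

end

end SHB

/-! Heavy ball is gradient descent in disguise: with v the last displacement, the point y = w +
β/(1-β) v moves by exactly -α/(1-β) ∇ℓ(Z, w). Hence an energy V = ‖y - w_*‖² + const·‖v‖² decreases
by a multiple of α(ℓ(Z, w) - ℓ(Z, w_*)), up to a multiple of α²‖∇ℓ‖² (`energy_hbStep_le`).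
Smoothness and ℓ ≥ 0 give ‖∇ℓ‖² ≤ 2Lℓ, so for small α only O(α²) remains.

Gradients are not assumed bounded, so concentration is bootstrapped. Since ℓ(Z, w_*) ≤ M, pathwise V
grows at most like t^{1-p}, and p > 1/2 keeps α_t V_t bounded. This is what turns the loss
differences into an exponential supermartingale: they are bounded below by -M, and their second
moment is at most a multiple of V times (their mean plus 2M) (`sq_loss_sub_le`). The compensator
leaves an error of order α²V, which slowly decreasing weights absorb because Σ α² converges
(`lyapunov_sum_le`). With Λ = log(3T/δ), it follows that V_t and Σ α(F - F_*) are O(Λ) up to time T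
with high probability (`exists_energy_tail_bound`).

For the last iterate, the descent inequality along y contains -γ/2 ‖∇F(y)‖², γ = α/(1-β), which pays
for the exponential moment of the gradient noise. Summation by parts with growing weights started at
T₀ (`weight_mul_le_sum`) turns the bound on the weighted sum into one for F(y_T) - F_*: the sum
contributes O(Λ)/Σα, velocities and squared steps O(Λ T₀^{1-2p}), and the noise O(Λ² T₀^{-p}), which
is O(Λ² T₀^{1-2p}) as p < 1. Velocities are small, so the bound passes from y back to w
(`exists_last_iterate_bound`). -/

namespace SHB

set_option linter.unusedSectionVars false

/-! ### Smooth convex functions -/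

section Smooth

/-- A quadratic upper bound and a lower bound control the slope vector. -/
theorem sq_norm_le_of_quadratic_bound {V : Type*} [NormedAddCommGroup V]
    [InnerProductSpace ℝ V] {f : V → ℝ} {L m : ℝ} (hL : 0 < L) {x g : V}
    (hq : ∀ y, f y ≤ f x + inner ℝ g (y - x) + L / 2 * ‖y - x‖ ^ 2) (hm : ∀ y, m ≤ f y) :
    ‖g‖ ^ 2 ≤ 2 * L * (f x - m) := by
  -- The test point x - g/L minimizes the quadratic upper bound.
  have h := (hm _).trans (hq (x - L⁻¹ • g))
  have e : x - L⁻¹ • g - x = -(L⁻¹ • g) := by abel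
  rw [e, inner_neg_right, real_inner_smul_right, real_inner_self_eq_norm_sq, norm_neg, norm_smul,
    Real.norm_of_nonneg (inv_nonneg.2 hL.le)] at h
  have h2 : L⁻¹ * ‖g‖ ^ 2 ≤ 2 * (f x - m) := by
    have : L / 2 * (L⁻¹ * ‖g‖) ^ 2 = L⁻¹ * ‖g‖ ^ 2 / 2 := by field_simp
    linarith
  rw [inv_mul_le_iff₀ hL] at h2
  linarith

variable {V : Type*} [NormedAddCommGroup V] [InnerProductSpace ℝ V] [CompleteSpace V]

theorem hasDerivAt_comp_line {f : V → ℝ} (hf : Differentiable ℝ f) (x h : V) (t : ℝ) :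
    HasDerivAt (fun s : ℝ => f (x + s • h)) (inner ℝ (gradient f (x + t • h)) h) t := by
  have h1 : HasDerivAt (fun s : ℝ => x + s • h) h t := by
    simpa using ((hasDerivAt_id t).smul_const h).const_add x
  have h2 := ((hf (x + t • h)).hasGradientAt).hasFDerivAt
  exact (h2.comp_hasDerivAt t h1).congr_deriv (by simp)

/-- The quadratic upper bound for a function with Lipschitz gradient. -/
theorem le_quadratic_of_lipschitz_gradient {f : V → ℝ} {L : ℝ} (hf : Differentiable ℝ f)
    (hL : ∀ u v, ‖gradient f u - gradient f v‖ ≤ L * ‖u - v‖) (x y : V) :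
    f y ≤ f x + inner ℝ (gradient f x) (y - x) + L / 2 * ‖y - x‖ ^ 2 := by
  set h := y - x with hh
  -- Along the segment, subtracting the quadratic leaves a function with nonpositive derivative; the
  -- claim is φ(1) ≤ φ(0).
  let φ : ℝ → ℝ := fun t => f (x + t • h) - t * inner ℝ (gradient f x) h - L / 2 * t ^ 2 * ‖h‖ ^ 2
  have hd : ∀ t, HasDerivAt φ
      (inner ℝ (gradient f (x + t • h)) h - inner ℝ (gradient f x) h - L * t * ‖h‖ ^ 2) t := by
    intro t
    have e1 := hasDerivAt_comp_line hf x h t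
    have e2 := (hasDerivAt_id t).mul_const (inner ℝ (gradient f x) h)
    have e3 := (((hasDerivAt_id t).pow 2).const_mul (L / 2)).mul_const (‖h‖ ^ 2)
    refine ((e1.sub e2).sub e3).congr_deriv ?_
    simp only [id_eq, Nat.cast_ofNat, Nat.add_one_sub_one, pow_one, mul_one, one_mul]
    ring
  have hanti : AntitoneOn φ (Set.Icc 0 1) := by
    refine antitoneOn_of_deriv_nonpos (convex_Icc 0 1)
      (fun t _ => (hd t).continuousAt.continuousWithinAt)
      (fun t _ => (hd t).differentiableAt.differentiableWithinAt) ?_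
    intro t ht
    rw [interior_Icc] at ht
    rw [(hd t).deriv, ← inner_sub_left]
    have h1 := real_inner_le_norm (gradient f (x + t • h) - gradient f x) h
    have h2 := hL (x + t • h) x
    rw [add_sub_cancel_left, norm_smul, Real.norm_of_nonneg ht.1.le] at h2
    nlinarith [norm_nonneg h, mul_le_mul_of_nonneg_right h2 (norm_nonneg h)]
  have := hanti (Set.left_mem_Icc.2 zero_le_one) (Set.right_mem_Icc.2 zero_le_one) zero_le_one
  simp only [φ, one_smul, zero_smul, add_zero] at this
  rw [show x + h = y by simp [hh]] at this
  nlinarith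

/-- The first-order inequality for a differentiable convex function. -/
theorem sub_le_inner_gradient {f : V → ℝ} (hf : Differentiable ℝ f)
    (hc : ConvexOn ℝ Set.univ f) (x y : V) :
    f x - f y ≤ inner ℝ (gradient f x) (x - y) := by
  have hcl : ConvexOn ℝ Set.univ (fun s : ℝ => f (x + s • (y - x))) := by
    have := hc.comp_affineMap (AffineMap.lineMap x y : ℝ →ᵃ[ℝ] V)
    rw [Set.preimage_univ] at this
    have e : (fun s : ℝ => f (x + s • (y - x))) = f ∘ (AffineMap.lineMap x y : ℝ →ᵃ[ℝ] V) := by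
      ext s
      simp [AffineMap.lineMap_apply, add_comm]
    rw [e]
    exact this
  have hd := hasDerivAt_comp_line hf x (y - x) 0
  have := hcl.le_slope_of_hasDerivAt (Set.mem_univ 0) (Set.mem_univ 1) zero_lt_one hd
  simp only [slope_def_field, zero_smul, add_zero, one_smul, sub_zero, div_one,
    add_sub_cancel] at this
  have e : inner ℝ (gradient f x) (x - y) = - inner ℝ (gradient f x) (y - x) := by
    rw [← inner_neg_right, neg_sub]
  rw [e]
  linarith

end Smooth

/-! ### Power sums and damped recursions -/

section Sums

/-- Bernoulli's inequality for an exponent in [0, 1], taken at -1/(x + 1). The comparisons of powers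
with telescoping differences rest on it. -/
theorem rpow_div_add_one_le {x q : ℝ} (hx : 0 < x) (hq0 : 0 ≤ q) (hq1 : q ≤ 1) :
    x ^ q ≤ (x + 1) ^ q * (1 - q / (x + 1)) := by
  have h := rpow_one_add_le_one_add_mul_self (s := -(1 / (x + 1)))
    (by rw [neg_le_neg_iff, div_le_one (by linarith)]; linarith) hq0 hq1
  have e : 1 + -(1 / (x + 1)) = x / (x + 1) := by field_simp; ring
  rw [e, Real.div_rpow hx.le (by linarith), div_le_iff₀ (by positivity)] at h
  calc x ^ q ≤ _ := h
    _ = _ := by ring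

theorem rpow_neg_le_sub {x p : ℝ} (hx : 1 ≤ x) (hp : 0 ≤ p) (hp1 : p ≤ 1) :
    (1 - p) / 2 * x ^ (-p) ≤ (x + 1) ^ (1 - p) - x ^ (1 - p) := by
  have h := rpow_div_add_one_le (x := x) (q := 1 - p) (by linarith) (by linarith) (by linarith)
  have e1 : (x + 1) ^ (1 - p) = (x + 1) * (x + 1) ^ (-p) := by
    rw [sub_eq_add_neg, Real.rpow_add (by linarith), Real.rpow_one]
  have e2 : (x + 1) ^ (1 - p) * (1 - (1 - p) / (x + 1))
      = (x + 1) ^ (1 - p) - (1 - p) * (x + 1) ^ (-p) := by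
    rw [e1]; field_simp
  -- The factor 1/2 in the statement pays for replacing x + 1 by x, since (x + 1)^p ≤ 2 x^p.
  have h3 : x ^ (-p) / 2 ≤ (x + 1) ^ (-p) := by
    rw [Real.rpow_neg (by linarith), Real.rpow_neg (by linarith)]
    have h4 : (x + 1) ^ p ≤ 2 * x ^ p := by
      calc (x + 1) ^ p ≤ (2 * x) ^ p := Real.rpow_le_rpow (by linarith) (by linarith) hp
        _ = 2 ^ p * x ^ p := Real.mul_rpow (by norm_num) (by linarith)
        _ ≤ 2 ^ (1 : ℝ) * x ^ p := by
          gcongr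
          norm_num
        _ = _ := by simp
    rw [inv_eq_one_div, div_div, inv_eq_one_div]
    exact one_div_le_one_div_of_le (by positivity) (by linarith)
  rw [e2] at h
  nlinarith

theorem rpow_neg_add_one_le_sub {x q : ℝ} (hx : 1 ≤ x) (hq : 0 ≤ q) (hq1 : q ≤ 1) :
    q / 2 * x ^ (-(1 + q)) ≤ x ^ (-q) - (x + 1) ^ (-q) := by
  have hx0 : 0 < x := by linarith
  have h := rpow_div_add_one_le (x := x) (q := q) hx0 hq hq1
  have hA : 0 < x ^ q := by positivity
  have hB : 0 < (x + 1) ^ q := by positivity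
  have h1 : (x + 1) ^ (-q) ≤ x ^ (-q) * (1 - q / (x + 1)) := by
    rw [Real.rpow_neg hx0.le, Real.rpow_neg (by linarith), inv_mul_eq_div, le_div_iff₀ hA,
      inv_mul_le_iff₀ hB]
    exact h
  have e : x ^ (-(1 + q)) = x ^ (-q) / x := by
    rw [neg_add, add_comm, Real.rpow_add hx0, Real.rpow_neg_one]; rfl
  have h2 : q / 2 * (x ^ (-q) / x) ≤ x ^ (-q) * (q / (x + 1)) := by
    have : q / 2 * (x ^ (-q) / x) = x ^ (-q) * (q / (2 * x)) := by field_simp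
    rw [this]
    gcongr
    linarith
  rw [e]
  linarith

theorem sum_range_rpow_neg_le {p : ℝ} (hp : 0 ≤ p) (hp1 : p < 1) (n : ℕ) :
    ∑ k ∈ Finset.range n, ((k : ℝ) + 1) ^ (-p) ≤ 2 / (1 - p) * ((n : ℝ) + 1) ^ (1 - p) := by
  have hq : 0 < 1 - p := by linarith
  induction n with
  | zero => simp; positivity
  | succ n ih =>
    rw [Finset.sum_range_succ]
    have h := rpow_neg_le_sub (x := (n : ℝ) + 1) (by simp) hp hp1.le
    have h2 := mul_le_mul_of_nonneg_left h (by positivity : 0 ≤ 2 / (1 - p))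
    have e : 2 / (1 - p) * ((1 - p) / 2 * ((n : ℝ) + 1) ^ (-p)) = ((n : ℝ) + 1) ^ (-p) := by
      field_simp
    push_cast
    linarith

theorem sum_Ico_rpow_neg_le {q : ℝ} (hq : 0 < q) (hq1 : q ≤ 1) (m n : ℕ) :
    ∑ k ∈ Finset.Ico m n, ((k : ℝ) + 1) ^ (-(1 + q)) ≤ 2 / q * ((m : ℝ) + 1) ^ (-q) := by
  -- Keeping the subtracted end term makes the induction telescope.
  suffices h : ∀ n, m ≤ n → ∑ k ∈ Finset.Ico m n, ((k : ℝ) + 1) ^ (-(1 + q)) ≤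
      2 / q * (((m : ℝ) + 1) ^ (-q) - ((n : ℝ) + 1) ^ (-q)) by
    rcases le_total m n with hmn | hmn
    · refine (h n hmn).trans ?_
      gcongr
      have : 0 ≤ ((n : ℝ) + 1) ^ (-q) := by positivity
      linarith
    · rw [Finset.Ico_eq_empty_of_le hmn]
      simp; positivity
  intro n hn
  induction n, hn using Nat.le_induction with
  | base => simp
  | succ n hn ih =>
    rw [Finset.sum_Ico_succ_top hn]
    have h := rpow_neg_add_one_le_sub (x := (n : ℝ) + 1) (by simp) hq.le hq1
    have h2 := mul_le_mul_of_nonneg_left h (by positivity : 0 ≤ 2 / q)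
    have e : 2 / q * (q / 2 * ((n : ℝ) + 1) ^ (-(1 + q))) = ((n : ℝ) + 1) ^ (-(1 + q)) := by
      field_simp
    push_cast
    linarith

/-- A geometrically damped recursion with a polynomially decaying forcing term decays
polynomially. -/
theorem exists_le_rpow_neg_of_damped {β q : ℝ} (hβ0 : 0 ≤ β) (hβ : β < 1) (hq : 0 ≤ q)
    (hq1 : q ≤ 1) :
    ∃ C, 0 < C ∧ ∀ (u : ℕ → ℝ) (c : ℝ) (T : ℕ), 0 ≤ c → u 0 = 0 →
      (∀ n < T, u (n + 1) ≤ β * u n + c * ((n : ℝ) + 1) ^ (-q)) →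
      ∀ n ≤ T, u n ≤ C * c * ((n : ℝ) + 1) ^ (-q) := by
  -- For x ≥ s = 2/(1-β) one has x/(x + 1) ≥ (1 + β)/2. Shifting n + 1 by s thus makes consecutive
  -- powers decay more slowly than the damping β from the very start, and the spare (1-β)/2 absorbs
  -- the forcing.
  obtain ⟨s, hs⟩ : ∃ s : ℝ, s = 2 / (1 - β) := ⟨_, rfl⟩
  have hs0 : 0 < s := by rw [hs]; apply div_pos <;> linarith
  have hs1 : 1 / s = (1 - β) / 2 := by rw [hs]; field_simp
  refine ⟨2 * (1 + s) ^ q / (1 - β), by apply div_pos; positivity; linarith, ?_⟩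
  intro u c T hc h0 hu
  set C := 2 * (1 + s) ^ q / (1 - β) with hC
  have hC0 : 0 ≤ C := by rw [hC]; apply div_nonneg; positivity; linarith
  have hCe : C * ((1 - β) / 2) = (1 + s) ^ q := by
    have : 1 - β ≠ 0 := by linarith
    rw [hC]; field_simp
  have key : ∀ n ≤ T, u n ≤ C * c * ((n : ℝ) + 1 + s) ^ (-q) := by
    intro n
    induction n with
    | zero => intro _; rw [h0]; positivity
    | succ n ih =>
      intro hn
      have h1 := hu n (by omega)
      have h2 := mul_le_mul_of_nonneg_left (ih (by omega)) hβ0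
      set x : ℝ := (n : ℝ) + 1 + s with hx
      have hn0 : (0 : ℝ) ≤ n := Nat.cast_nonneg n
      have hxs : s ≤ x := by linarith
      have hx0 : 0 < x := by linarith
      -- This is n + 1 + s ≤ (n + 1)(1 + s), the origin of (1 + s)^q in the constant.
      have h3 : ((n : ℝ) + 1) ^ (-q) ≤ (1 + s) ^ q * x ^ (-q) := by
        rw [Real.rpow_neg (by positivity), Real.rpow_neg hx0.le, ← div_eq_mul_inv,
          le_div_iff₀ (by positivity), inv_mul_le_iff₀ (by positivity),
          ← Real.mul_rpow (by positivity) (by positivity)]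
        exact Real.rpow_le_rpow hx0.le (by rw [hx]; nlinarith) hq
      have h4 : x ^ (-q) * (1 - (1 - β) / 2) ≤ (x + 1) ^ (-q) := by
        have h5 := rpow_div_add_one_le (x := x) (q := q) hx0 hq hq1
        have h6 : x / (x + 1) ≤ (x / (x + 1)) ^ q := by
          conv_lhs => rw [← Real.rpow_one (x / (x + 1))]
          exact Real.rpow_le_rpow_of_exponent_ge (by positivity)
            (by rw [div_le_one (by linarith)]; linarith) hq1
        rw [Real.div_rpow hx0.le (by linarith), le_div_iff₀ (by positivity)] at h6
        rw [Real.rpow_neg hx0.le, Real.rpow_neg (by linarith), inv_mul_eq_div,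
          div_le_iff₀ (by positivity), inv_mul_eq_div, le_div_iff₀ (by positivity)]
        refine le_trans ?_ h6
        gcongr
        rw [le_div_iff₀ (by linarith)]
        have : 1 ≤ (1 - β) / 2 * x := by
          rw [← hs1, one_div, ← div_eq_inv_mul, le_div_iff₀ hs0]; linarith
        nlinarith
      have h7 := mul_le_mul_of_nonneg_left h4 (by positivity : 0 ≤ C * c)
      have h8 := mul_le_mul_of_nonneg_left h3 hc
      have e : ((n + 1 : ℕ) : ℝ) + 1 + s = x + 1 := by rw [hx]; push_cast; ring
      rw [e]
      refine h1.trans (le_trans ?_ h7)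
      have e2 : c * ((1 + s) ^ q * x ^ (-q)) = C * c * x ^ (-q) * ((1 - β) / 2) := by
        rw [← hCe]; ring
      rw [e2] at h8
      linarith
  intro n hn
  refine (key n hn).trans ?_
  have : ((n : ℝ) + 1 + s) ^ (-q) ≤ ((n : ℝ) + 1) ^ (-q) :=
    Real.rpow_le_rpow_of_nonpos (by positivity) (by linarith) (by linarith)
  gcongr

end Sums

/-! ### Exponential supermartingales -/

section Exponential

/-- The σ-algebra generated by the first `n` terms of a sequence of random variables. -/
@[reducible] def pastσ {Ω E : Type*} [MeasurableSpace E] (ζ : ℕ → Ω → E) (n : ℕ) :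
    MeasurableSpace Ω :=
  ⨆ k ∈ Set.Iio n, MeasurableSpace.comap (ζ k) inferInstance

theorem pastσ_mono {Ω E : Type*} [MeasurableSpace E] {ζ : ℕ → Ω → E} {m n : ℕ} (h : m ≤ n) :
    pastσ ζ m ≤ pastσ ζ n :=
  biSup_mono fun _ hk => lt_of_lt_of_le hk h

theorem measurable_pastσ {Ω E : Type*} [MeasurableSpace E] {ζ : ℕ → Ω → E} {k n : ℕ} (h : k < n) :
    Measurable[pastσ ζ n] (ζ k) :=
  Measurable.mono (comap_measurable (ζ k)) (le_iSup₂_of_le k h le_rfl) le_rfl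

variable {Ω E S : Type*} [MeasurableSpace Ω] [MeasurableSpace E] [MeasurableSpace S]
  {P : Measure Ω} {μ : Measure E} {ζ : ℕ → Ω → E}

theorem pastσ_le (hζ : ∀ n, Measurable (ζ n)) (n : ℕ) : pastσ ζ n ≤ ‹MeasurableSpace Ω› :=
  iSup₂_le fun k _ => (hζ k).comap_le

theorem indepFun_of_measurable_pastσ (hζ : ∀ n, Measurable (ζ n)) (hind : iIndepFun ζ P)
    {n : ℕ} {Y : Ω → S} (hY : Measurable[pastσ ζ n] Y) : IndepFun Y (ζ n) P := by
  have h := indep_iSup_of_disjoint (fun k => (hζ k).comap_le) hind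
    (show Disjoint (Set.Iio n) ({n} : Set ℕ) by simp)
  rw [iSup_singleton] at h
  exact indep_of_indep_of_le_left h hY.comap_le

/-- Exponential supermartingale bound: if every increment has conditional exponential moment at
most one, so does the sum. -/
theorem lintegral_exp_sum_le_one [IsProbabilityMeasure P] [IsProbabilityMeasure μ]
    (hζ : ∀ n, Measurable (ζ n)) (hind : iIndepFun ζ P) (hlaw : ∀ n, P.map (ζ n) = μ)
    {X : ℕ → Ω → S} (hX : ∀ n, Measurable[pastσ ζ n] (X n))
    {f : ℕ → S → E → ℝ} (hf : ∀ n, Measurable (Function.uncurry (f n))) (m n : ℕ)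
    (hstep : ∀ k, m ≤ k → k < n → ∀ ω,
      ∫⁻ z, ENNReal.ofReal (Real.exp (f k (X k ω) z)) ∂μ ≤ 1) :
    ∫⁻ ω, ENNReal.ofReal (Real.exp (∑ k ∈ Finset.Ico m n, f k (X k ω) (ζ k ω))) ∂P ≤ 1 := by
  have hA : ∀ n, Measurable[pastσ ζ n]
      (fun ω => ∑ k ∈ Finset.Ico m n, f k (X k ω) (ζ k ω)) := by
    intro n
    refine Finset.measurable_sum _ fun k hk => ?_
    have hk' := (Finset.mem_Ico.1 hk).2
    exact (hf k).comp (((hX k).mono (pastσ_mono hk'.le) le_rfl).prodMk (measurable_pastσ hk'))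
  rcases le_total n m with hnm | hmn
  · simp [Finset.Ico_eq_empty_of_le hnm]
  induction n, hmn using Nat.le_induction with
  | base => simp
  | succ n hn ih =>
    -- State and partial sum are functions of the past, so their joint law with the next sample is a
    -- product; Tonelli then integrates the sample first, with the state frozen.
    let A : Ω → ℝ := fun ω => ∑ k ∈ Finset.Ico m n, f k (X k ω) (ζ k ω)
    let Y : Ω → S × ℝ := fun ω => (X n ω, A ω)
    have hY : Measurable[pastσ ζ n] Y := (hX n).prodMk (hA n)
    have hY' : Measurable Y := hY.mono (pastσ_le hζ n) le_rfl
    have hI := indepFun_of_measurable_pastσ hζ hind hY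
    rw [indepFun_iff_map_prod_eq_prod_map_map hY'.aemeasurable (hζ n).aemeasurable, hlaw n] at hI
    let H : (S × ℝ) × E → ENNReal := fun y => ENNReal.ofReal (Real.exp (y.1.2 + f n y.1.1 y.2))
    have hH : Measurable H := by
      have : Measurable fun y : (S × ℝ) × E => f n y.1.1 y.2 :=
        (hf n).comp (Measurable.prodMk (by fun_prop) (by fun_prop) :
          Measurable fun y : (S × ℝ) × E => (y.1.1, y.2))
      exact (Real.measurable_exp.comp ((by fun_prop :
        Measurable fun y : (S × ℝ) × E => y.1.2).add this)).ennreal_ofReal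
    have e1 : ∫⁻ ω, ENNReal.ofReal
        (Real.exp (∑ k ∈ Finset.Ico m (n + 1), f k (X k ω) (ζ k ω))) ∂P
        = ∫⁻ ω, H (Y ω, ζ n ω) ∂P := by
      simp only [Finset.sum_Ico_succ_top hn, H, Y, A]
    have : IsProbabilityMeasure (P.map Y) := Measure.isProbabilityMeasure_map hY'.aemeasurable
    rw [e1, ← lintegral_map hH (hY'.prodMk (hζ n)), hI, lintegral_prod _ hH.aemeasurable,
      lintegral_map hH.lintegral_prod_right' hY']
    refine le_trans (lintegral_mono fun ω => ?_)
      (ih fun k hk hkn => hstep k hk (hkn.trans (Nat.lt_succ_self n)))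
    simp only [H, Y, Real.exp_add]
    have hmz : Measurable fun z => ENNReal.ofReal (Real.exp (f n (X n ω) z)) :=
      (Real.measurable_exp.comp ((hf n).comp measurable_prodMk_left)).ennreal_ofReal
    calc ∫⁻ z, ENNReal.ofReal (Real.exp (A ω) * Real.exp (f n (X n ω) z)) ∂μ
        = ENNReal.ofReal (Real.exp (A ω)) *
          ∫⁻ z, ENNReal.ofReal (Real.exp (f n (X n ω) z)) ∂μ := by
          rw [← lintegral_const_mul _ hmz]
          exact lintegral_congr fun z => ENNReal.ofReal_mul (Real.exp_nonneg _)
      _ ≤ ENNReal.ofReal (Real.exp (A ω)) * 1 := by gcongr; exact hstep n hn (Nat.lt_succ_self n) ω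
      _ = _ := mul_one _

/-- Chernoff: Markov's inequality applied to the exponential of the sum. -/
theorem measure_sum_ge_le_exp_neg [IsProbabilityMeasure P] [IsProbabilityMeasure μ]
    (hζ : ∀ n, Measurable (ζ n)) (hind : iIndepFun ζ P) (hlaw : ∀ n, P.map (ζ n) = μ)
    {X : ℕ → Ω → S} (hX : ∀ n, Measurable[pastσ ζ n] (X n))
    {f : ℕ → S → E → ℝ} (hf : ∀ n, Measurable (Function.uncurry (f n))) (m n : ℕ)
    (hstep : ∀ k, m ≤ k → k < n → ∀ ω,
      ∫⁻ z, ENNReal.ofReal (Real.exp (f k (X k ω) z)) ∂μ ≤ 1) (u : ℝ) :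
    P {ω | u ≤ ∑ k ∈ Finset.Ico m n, f k (X k ω) (ζ k ω)} ≤ ENNReal.ofReal (Real.exp (-u)) := by
  have h1 := lintegral_exp_sum_le_one hζ hind hlaw hX hf m n hstep
  have hA : Measurable (fun ω => ∑ k ∈ Finset.Ico m n, f k (X k ω) (ζ k ω)) :=
    Finset.measurable_sum _ fun k _ =>
      (hf k).comp (((hX k).mono (pastσ_le hζ k) le_rfl).prodMk (hζ k))
  have h2 := mul_meas_ge_le_lintegral (μ := P) (Real.measurable_exp.comp hA).ennreal_ofReal
    (ENNReal.ofReal (Real.exp u))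
  have h3 : {ω | u ≤ ∑ k ∈ Finset.Ico m n, f k (X k ω) (ζ k ω)} ⊆ {ω | ENNReal.ofReal (Real.exp u)
      ≤ ENNReal.ofReal ((Real.exp ∘ fun ω => ∑ k ∈ Finset.Ico m n, f k (X k ω) (ζ k ω)) ω)} :=
    fun ω hω => ENNReal.ofReal_le_ofReal (Real.exp_le_exp.2 hω)
  have h4 := (mul_le_mul_right (measure_mono (μ := P) h3) (ENNReal.ofReal (Real.exp u))).trans
    (h2.trans h1)
  rw [Real.exp_neg, ENNReal.ofReal_inv_of_pos (Real.exp_pos u)]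
  rw [ENNReal.le_inv_iff_mul_le, mul_comm]
  exact h4

/-- Only an upper bound on x is needed, which suits x = -θY with Y bounded below but not above. For
x ≤ -1 the right side is at least 1. -/
theorem exp_le_one_add_add_sq {x : ℝ} (hx : x ≤ 1) : Real.exp x ≤ 1 + x + x ^ 2 := by
  rcases le_total (-1) x with h | h
  · have := Real.abs_exp_sub_one_sub_id_le (abs_le.2 ⟨h, hx⟩)
    linarith [(abs_le.1 this).2]
  · have : Real.exp x ≤ 1 := Real.exp_le_one_iff.2 (by linarith)
    nlinarith

/-- A bound on the exponential moment from an integrable majorant of `exp X`. -/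
theorem lintegral_exp_sub_le_one [IsProbabilityMeasure μ] {X A : E → ℝ} {u : ℝ}
    (hXA : ∀ z, Real.exp (X z) ≤ 1 + A z) (hA : Integrable A μ) (hu : ∫ z, A z ∂μ ≤ u) :
    ∫⁻ z, ENNReal.ofReal (Real.exp (X z - u)) ∂μ ≤ 1 := by
  have hI : Integrable (fun z => (1 + A z) * Real.exp (-u)) μ :=
    ((integrable_const 1).add hA).mul_const _
  calc ∫⁻ z, ENNReal.ofReal (Real.exp (X z - u)) ∂μ
      ≤ ∫⁻ z, ENNReal.ofReal ((1 + A z) * Real.exp (-u)) ∂μ := by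
        refine lintegral_mono fun z => ENNReal.ofReal_le_ofReal ?_
        rw [sub_eq_add_neg, Real.exp_add]
        exact mul_le_mul_of_nonneg_right (hXA z) (Real.exp_nonneg _)
    _ = ENNReal.ofReal (∫ z, (1 + A z) * Real.exp (-u) ∂μ) := by
        rw [ofReal_integral_eq_lintegral_ofReal hI]
        exact Filter.Eventually.of_forall fun z =>
          mul_nonneg ((Real.exp_nonneg _).trans (hXA z)) (Real.exp_nonneg _)
    _ ≤ ENNReal.ofReal 1 := by
        refine ENNReal.ofReal_le_ofReal ?_
        rw [integral_mul_const, integral_add (integrable_const 1) hA]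
        simp only [integral_const, probReal_univ, smul_eq_mul, mul_one]
        calc (1 + ∫ z, A z ∂μ) * Real.exp (-u) ≤ Real.exp u * Real.exp (-u) := by
              gcongr
              linarith [Real.add_one_le_exp u]
          _ = 1 := by rw [← Real.exp_add]; simp
    _ = 1 := by simp

end Exponential

/-! ### Smooth random losses and their mean -/

section Loss

variable {V : Type*} [NormedAddCommGroup V] [InnerProductSpace ℝ V] [MeasurableSpace V]

/-- A random nonnegative convex `L`-smooth loss `ℓ(z, ·)` with gradient `g(z, ·)` whose mean is
minimized at `wstar`, where the loss is at most `M`. -/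
structure IsSmoothLoss {E : Type*} [MeasurableSpace E] (L M : ℝ) (μ : Measure E) (ℓ : E → V → ℝ)
    (g : E → V → V) (wstar : V) : Prop where
  nonneg : ∀ z w, 0 ≤ ℓ z w
  le_quadratic : ∀ z x y, ℓ z y ≤ ℓ z x + inner ℝ (g z x) (y - x) + L / 2 * ‖y - x‖ ^ 2
  sub_le_inner : ∀ z x y, ℓ z x - ℓ z y ≤ inner ℝ (g z x) (x - y)
  lipschitz : ∀ z x y, ‖g z x - g z y‖ ≤ L * ‖x - y‖
  measurable : Measurable (Function.uncurry ℓ)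
  measurable_grad : Measurable (Function.uncurry g)
  integrable : ∀ w, Integrable (fun z => ℓ z w) μ
  integrable_grad : ∀ w, Integrable (fun z => g z w) μ
  minimizer : ∀ w, ∫ z, ℓ z wstar ∂μ ≤ ∫ z, ℓ z w ∂μ
  le_bound : ∀ z, ℓ z wstar ≤ M

/-- The excess risk. -/
noncomputable def excess {E : Type*} [MeasurableSpace E] (μ : Measure E) (ℓ : E → V → ℝ)
    (wstar w : V) : ℝ :=
  ∫ z, ℓ z w ∂μ - ∫ z, ℓ z wstar ∂μ

/-- The mean gradient. -/
noncomputable def meanGrad {E : Type*} [MeasurableSpace E] (μ : Measure E) (g : E → V → V)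
    (w : V) : V :=
  ∫ z, g z w ∂μ

namespace IsSmoothLoss

variable {E : Type*} [MeasurableSpace E] {L M : ℝ} {μ : Measure E} {ℓ : E → V → ℝ}
  {g : E → V → V} {wstar : V}

theorem sq_grad_le (h : IsSmoothLoss L M μ ℓ g wstar) (hL : 0 < L) (z : E) (w : V) :
    ‖g z w‖ ^ 2 ≤ 2 * L * ℓ z w := by
  simpa using sq_norm_le_of_quadratic_bound hL (h.le_quadratic z w) (h.nonneg z)

theorem sq_grad_le_of_dist (h : IsSmoothLoss L M μ ℓ g wstar) (hL : 0 < L) (z : E) (w : V) :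
    ‖g z w‖ ^ 2 ≤ 4 * L * M + 2 * L ^ 2 * ‖w - wstar‖ ^ 2 := by
  have h1 := h.sq_grad_le hL z wstar
  have h2 := h.lipschitz z w wstar
  have h3 := h.le_bound z
  have h4 : ‖g z w‖ ≤ ‖g z wstar‖ + ‖g z w - g z wstar‖ := norm_le_insert' _ _
  have h5 : ‖g z w - g z wstar‖ ^ 2 ≤ (L * ‖w - wstar‖) ^ 2 := by gcongr
  have h6 : ‖g z w‖ ^ 2 ≤ (‖g z wstar‖ + ‖g z w - g z wstar‖) ^ 2 := by gcongr
  nlinarith [sq_nonneg (‖g z wstar‖ - ‖g z w - g z wstar‖)]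

/-- The difference is at most gradient times distance, with the gradient taken at the point of
larger loss, where its square is at most 2L times that loss. In either case ℓ(z, w_*) ≤ M bounds
this larger loss by the difference plus 2M. Being linear in the difference, the bound integrates to
one by the excess risk. -/
theorem sq_loss_sub_le (h : IsSmoothLoss L M μ ℓ g wstar) (hL : 0 < L) (hM : 0 ≤ M) (z : E)
    (w : V) : (ℓ z w - ℓ z wstar) ^ 2 ≤
      2 * L * ‖w - wstar‖ ^ 2 * (ℓ z w - ℓ z wstar + 2 * M) := by
  have hb := h.le_bound z
  have hn := h.nonneg z w
  rcases le_total 0 (ℓ z w - ℓ z wstar) with hY | hY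
  · have h1 := (h.sub_le_inner z w wstar).trans (real_inner_le_norm _ _)
    calc (ℓ z w - ℓ z wstar) ^ 2 ≤ (‖g z w‖ * ‖w - wstar‖) ^ 2 := by gcongr
      _ = ‖g z w‖ ^ 2 * ‖w - wstar‖ ^ 2 := by ring
      _ ≤ (2 * L * ℓ z w) * ‖w - wstar‖ ^ 2 := by gcongr; exact h.sq_grad_le hL z w
      _ = 2 * L * ‖w - wstar‖ ^ 2 * ℓ z w := by ring
      _ ≤ _ := by gcongr; linarith
  · have h1 := (h.sub_le_inner z wstar w).trans (real_inner_le_norm _ _)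
    rw [norm_sub_rev] at h1
    calc (ℓ z w - ℓ z wstar) ^ 2 = (ℓ z wstar - ℓ z w) ^ 2 := by ring
      _ ≤ (‖g z wstar‖ * ‖w - wstar‖) ^ 2 := by
        have : 0 ≤ ℓ z wstar - ℓ z w := by linarith
        gcongr
      _ = ‖g z wstar‖ ^ 2 * ‖w - wstar‖ ^ 2 := by ring
      _ ≤ (2 * L * ℓ z wstar) * ‖w - wstar‖ ^ 2 := by gcongr; exact h.sq_grad_le hL z wstar
      _ = 2 * L * ‖w - wstar‖ ^ 2 * ℓ z wstar := by ring
      _ ≤ _ := by gcongr; linarith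

theorem excess_nonneg (h : IsSmoothLoss L M μ ℓ g wstar) (w : V) : 0 ≤ excess μ ℓ wstar w :=
  sub_nonneg.2 (h.minimizer w)

theorem excess_star : excess μ ℓ wstar wstar = 0 := sub_self _

theorem measurable_excess [SFinite μ] (h : IsSmoothLoss L M μ ℓ g wstar) :
    Measurable (excess μ ℓ wstar) := by
  have : StronglyMeasurable fun w => ∫ z, ℓ z w ∂μ :=
    h.measurable.stronglyMeasurable.integral_prod_left
  exact this.measurable.sub_const _

section Complete

variable [CompleteSpace V]

theorem integral_inner_grad (h : IsSmoothLoss L M μ ℓ g wstar) (u w : V) :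
    ∫ z, inner ℝ u (g z w) ∂μ = inner ℝ u (meanGrad μ g w) :=
  integral_inner (h.integrable_grad w) u

variable [IsProbabilityMeasure μ]

/-- Integrating the samplewise bound gives everything needed of the mean gradient; it need not be
identified with the derivative of the mean loss. -/
theorem excess_le_quadratic (h : IsSmoothLoss L M μ ℓ g wstar) (x y : V) :
    excess μ ℓ wstar y ≤ excess μ ℓ wstar x + inner ℝ (meanGrad μ g x) (y - x)
      + L / 2 * ‖y - x‖ ^ 2 := by
  have hi : Integrable (fun z => inner ℝ (y - x) (g z x)) μ := (h.integrable_grad x).const_inner _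
  have h1 : ∫ z, ℓ z y ∂μ ≤ ∫ z, (ℓ z x + inner ℝ (y - x) (g z x) + L / 2 * ‖y - x‖ ^ 2) ∂μ := by
    refine integral_mono (h.integrable y) (((h.integrable x).add hi).add (integrable_const _)) ?_
    intro z
    have := h.le_quadratic z x y
    rwa [real_inner_comm] at this
  have hadd : Integrable (fun z => ℓ z x + inner ℝ (y - x) (g z x)) μ := (h.integrable x).add hi
  rw [integral_add hadd (integrable_const _), integral_add (h.integrable x) hi, h.integral_inner_grad, real_inner_comm] at h1
  simp only [integral_const, probReal_univ, one_smul] at h1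
  unfold excess
  linarith

theorem meanGrad_lipschitz (h : IsSmoothLoss L M μ ℓ g wstar) (x y : V) :
    ‖meanGrad μ g x - meanGrad μ g y‖ ≤ L * ‖x - y‖ := by
  unfold meanGrad
  rw [← integral_sub (h.integrable_grad x) (h.integrable_grad y)]
  simpa using norm_integral_le_of_norm_le_const (μ := μ)
    (Filter.Eventually.of_forall fun z => h.lipschitz z x y)

theorem sq_meanGrad_le (h : IsSmoothLoss L M μ ℓ g wstar) (hL : 0 < L) (x : V) :
    ‖meanGrad μ g x‖ ^ 2 ≤ 2 * L * excess μ ℓ wstar x := by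
  simpa using sq_norm_le_of_quadratic_bound hL (h.excess_le_quadratic x) h.excess_nonneg

theorem meanGrad_star (h : IsSmoothLoss L M μ ℓ g wstar) (hL : 0 < L) :
    meanGrad μ g wstar = 0 := by
  have := h.sq_meanGrad_le hL wstar
  rw [excess_star, mul_zero] at this
  have h2 : ‖meanGrad μ g wstar‖ = 0 := by
    apply pow_eq_zero_iff (two_ne_zero) |>.1
    exact le_antisymm this (sq_nonneg _)
  exact norm_eq_zero.1 h2

theorem norm_meanGrad_le (h : IsSmoothLoss L M μ ℓ g wstar) (hL : 0 < L) (x : V) :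
    ‖meanGrad μ g x‖ ≤ L * ‖x - wstar‖ := by
  simpa [h.meanGrad_star hL] using h.meanGrad_lipschitz x wstar

theorem excess_le_sq_dist (h : IsSmoothLoss L M μ ℓ g wstar) (hL : 0 < L) (x : V) :
    excess μ ℓ wstar x ≤ L / 2 * ‖x - wstar‖ ^ 2 := by
  simpa [h.meanGrad_star hL, excess_star] using h.excess_le_quadratic wstar x

/-- The linear term of the quadratic bound is split by Young's inequality, and the squared mean
gradient is at most 2L times the excess. This transfers bounds between iterates and auxiliary
points, in both directions. -/
theorem excess_le_two_mul_excess (h : IsSmoothLoss L M μ ℓ g wstar) (hL : 0 < L) (x y : V) :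
    excess μ ℓ wstar y ≤ 2 * excess μ ℓ wstar x + L * ‖y - x‖ ^ 2 := by
  have h1 := h.excess_le_quadratic x y
  have h2 := real_inner_le_norm (meanGrad μ g x) (y - x)
  have h3 := h.sq_meanGrad_le hL x
  have h4 : ‖meanGrad μ g x‖ * ‖y - x‖ ≤ excess μ ℓ wstar x + L / 2 * ‖y - x‖ ^ 2 := by
    have h5 := sq_nonneg (‖meanGrad μ g x‖ - L * ‖y - x‖)
    have h6 : 2 * L * (‖meanGrad μ g x‖ * ‖y - x‖) ≤
        2 * L * (excess μ ℓ wstar x + L / 2 * ‖y - x‖ ^ 2) := by nlinarith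
    exact le_of_mul_le_mul_left h6 (by positivity)
  linarith

end Complete

end IsSmoothLoss

end Loss

/-! ### Momentum as a plain gradient recursion, and its energy -/

section Dynamics

variable {V : Type*} [NormedAddCommGroup V] [InnerProductSpace ℝ V]

/-- One heavy ball step on pairs (position, velocity). -/
def hbStep (β a : ℝ) (x : V × V) (γ : V) : V × V :=
  (x.1 + (β • x.2 - a • γ), β • x.2 - a • γ)

/-- The heavy ball iterates as pairs (position, velocity). -/
def hbState {E : Type*} (g : E → V → V) (a : ℕ → ℝ) (β : ℝ) (w₀ : V) (ζ : ℕ → E) : ℕ → V × V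
  | 0 => (w₀, 0)
  | n + 1 => hbStep β (a n) (hbState g a β w₀ ζ n) (g (ζ n) (hbState g a β w₀ ζ n).1)

/-- The auxiliary point, which follows a plain gradient recursion. -/
noncomputable def auxPoint (β : ℝ) (x : V × V) : V := x.1 + (β / (1 - β)) • x.2

/-- The Lyapunov function of the heavy ball recursion. -/
noncomputable def energy (β : ℝ) (wstar : V) (x : V × V) : ℝ :=
  ‖auxPoint β x - wstar‖ ^ 2 + (β / (1 - β)) ^ 2 / (1 - β) * ‖x.2‖ ^ 2

/-- The coefficient of the squared gradient in the energy estimate. -/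
noncomputable def energyCoeff (β : ℝ) : ℝ := 2 / (1 - β) ^ 2 + (β / (1 - β)) ^ 2 / (1 - β) ^ 2

theorem energyCoeff_pos {β : ℝ} (hβ1 : β < 1) : 0 < energyCoeff β := by
  have : 0 < 1 - β := by linarith
  unfold energyCoeff
  positivity

theorem energy_nonneg {β : ℝ} (hβ1 : β < 1) (wstar : V) (x : V × V) :
    0 ≤ energy β wstar x := by
  have : 0 < 1 - β := by linarith
  unfold energy
  positivity

theorem sq_auxPoint_sub_le_energy {β : ℝ} (hβ1 : β < 1) (wstar : V) (x : V × V) :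
    ‖auxPoint β x - wstar‖ ^ 2 ≤ energy β wstar x := by
  have : 0 < 1 - β := by linarith
  unfold energy
  have : 0 ≤ (β / (1 - β)) ^ 2 / (1 - β) * ‖x.2‖ ^ 2 := by positivity
  linarith

theorem sq_dist_le_two_mul_energy {β : ℝ} (hβ0 : 0 ≤ β) (hβ1 : β < 1) (wstar : V) (x : V × V) :
    ‖x.1 - wstar‖ ^ 2 ≤ 2 * energy β wstar x := by
  have h1 : 0 < 1 - β := by linarith
  have e : x.1 - wstar = (auxPoint β x - wstar) - (β / (1 - β)) • x.2 := by
    unfold auxPoint; abel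
  have h2 : ‖x.1 - wstar‖ ≤ ‖auxPoint β x - wstar‖ + (β / (1 - β)) * ‖x.2‖ := by
    rw [e]
    refine (norm_sub_le _ _).trans ?_
    rw [norm_smul, Real.norm_of_nonneg (by positivity)]
  have h3 : (β / (1 - β)) ^ 2 * ‖x.2‖ ^ 2 ≤ (β / (1 - β)) ^ 2 / (1 - β) * ‖x.2‖ ^ 2 := by
    gcongr
    rw [le_div_iff₀ h1]
    nlinarith [sq_nonneg (β / (1 - β))]
  have h4 : ‖x.1 - wstar‖ ^ 2 ≤ (‖auxPoint β x - wstar‖ + (β / (1 - β)) * ‖x.2‖) ^ 2 := by gcongr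
  unfold energy
  nlinarith [sq_nonneg (‖auxPoint β x - wstar‖ - (β / (1 - β)) * ‖x.2‖)]

/-- With κ = β/(1-β), the identity (1 + κ)β = κ leaves the velocity contribution unchanged, while
the gradient picks up 1 + κ = 1/(1-β). -/
theorem auxPoint_hbStep {β : ℝ} (hβ1 : β < 1) (a : ℝ) (x : V × V) (γ : V) :
    auxPoint β (hbStep β a x γ) = auxPoint β x - (a / (1 - β)) • γ := by
  have h1 : 1 - β ≠ 0 := by linarith
  unfold auxPoint hbStep
  match_scalars <;> field_simp <;> ring

/-- The new velocity is a convex combination, with weights β and 1-β, of the old one and -aγ/(1-β).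
-/
theorem sq_norm_velocity_hbStep_le {β : ℝ} (hβ0 : 0 ≤ β) (hβ1 : β < 1) (a : ℝ) (x : V × V)
    (γ : V) :
    ‖(hbStep β a x γ).2‖ ^ 2 ≤ β * ‖x.2‖ ^ 2 + a ^ 2 * ‖γ‖ ^ 2 / (1 - β) := by
  have h1 : 0 < 1 - β := by linarith
  have h2 : ‖(hbStep β a x γ).2‖ ≤ β * ‖x.2‖ + |a| * ‖γ‖ := by
    unfold hbStep
    refine (norm_sub_le _ _).trans ?_
    rw [norm_smul, norm_smul, Real.norm_of_nonneg hβ0, Real.norm_eq_abs]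
  have h3 : ‖(hbStep β a x γ).2‖ ^ 2 ≤ (β * ‖x.2‖ + |a| * ‖γ‖) ^ 2 := by gcongr
  have h4 : a ^ 2 * ‖γ‖ ^ 2 / (1 - β) = (|a| * ‖γ‖ / (1 - β)) ^ 2 * (1 - β) := by
    rw [div_pow, mul_pow, sq_abs]; field_simp
  set s := |a| * ‖γ‖ / (1 - β) with hs
  have h5 : |a| * ‖γ‖ = s * (1 - β) := by rw [hs]; field_simp
  rw [h5] at h3
  rw [h4]
  nlinarith [mul_nonneg (mul_nonneg hβ0 h1.le) (sq_nonneg (‖x.2‖ - s))]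

/-- Expanding the squared distance of the auxiliary point leaves a gradient–velocity cross term.
Young's inequality costs κ²‖v‖², exactly what the contraction of the velocity by β releases from the
weight κ²/(1-β). -/
theorem energy_hbStep_le {β : ℝ} (hβ0 : 0 ≤ β) (hβ1 : β < 1) (a : ℝ) (wstar : V) (x : V × V)
    (γ : V) :
    energy β wstar (hbStep β a x γ) ≤ energy β wstar x
      - 2 * (a / (1 - β)) * inner ℝ γ (x.1 - wstar) + energyCoeff β * a ^ 2 * ‖γ‖ ^ 2 := by
  have h1 : 0 < 1 - β := by linarith
  have hv := sq_norm_velocity_hbStep_le hβ0 hβ1 a x γ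
  set κ := β / (1 - β) with hκ
  have hκ0 : 0 ≤ κ := by positivity
  have e1 : ‖auxPoint β (hbStep β a x γ) - wstar‖ ^ 2 = ‖auxPoint β x - wstar‖ ^ 2
      - 2 * (a / (1 - β)) * inner ℝ γ (x.1 - wstar) - 2 * ((a / (1 - β)) * (κ * inner ℝ γ x.2))
      + (a / (1 - β)) ^ 2 * ‖γ‖ ^ 2 := by
    rw [auxPoint_hbStep hβ1, sub_right_comm, norm_sub_sq_real, real_inner_smul_right, norm_smul,
      mul_pow, Real.norm_eq_abs, sq_abs, real_inner_comm]
    have : auxPoint β x - wstar = (x.1 - wstar) + κ • x.2 := by unfold auxPoint; abel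
    rw [show inner ℝ γ (auxPoint β x - wstar) = inner ℝ γ (x.1 - wstar) + κ * inner ℝ γ x.2 by
      rw [this, inner_add_right, real_inner_smul_right]]
    ring
  have h2 : - 2 * ((a / (1 - β)) * (κ * inner ℝ γ x.2)) ≤
      (a / (1 - β)) ^ 2 * ‖γ‖ ^ 2 + κ ^ 2 * ‖x.2‖ ^ 2 := by
    have h3 : 0 ≤ ‖(a / (1 - β)) • γ + κ • x.2‖ ^ 2 := sq_nonneg _
    rw [norm_add_sq_real, real_inner_smul_left, real_inner_smul_right, norm_smul, norm_smul,
      mul_pow, mul_pow, Real.norm_eq_abs, Real.norm_eq_abs, sq_abs, sq_abs] at h3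
    linarith
  have h4 := mul_le_mul_of_nonneg_left hv (by positivity : 0 ≤ κ ^ 2 / (1 - β))
  have e2 : κ ^ 2 / (1 - β) * (β * ‖x.2‖ ^ 2 + a ^ 2 * ‖γ‖ ^ 2 / (1 - β)) =
      κ ^ 2 / (1 - β) * ‖x.2‖ ^ 2 - κ ^ 2 * ‖x.2‖ ^ 2
        + κ ^ 2 / (1 - β) ^ 2 * a ^ 2 * ‖γ‖ ^ 2 := by
    field_simp; ring
  have e3 : energyCoeff β * a ^ 2 * ‖γ‖ ^ 2 = 2 * ((a / (1 - β)) ^ 2 * ‖γ‖ ^ 2)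
      + κ ^ 2 / (1 - β) ^ 2 * a ^ 2 * ‖γ‖ ^ 2 := by
    unfold energyCoeff; rw [← hκ]; field_simp
  unfold energy
  rw [← hκ, e1, e3]
  rw [e2] at h4
  linarith

end Dynamics

/-! ### Measurability of the iterates with respect to the past -/

section Measurability

variable {V : Type*} [NormedAddCommGroup V] [InnerProductSpace ℝ V] [MeasurableSpace V]
  [BorelSpace V] [SecondCountableTopology V]

theorem measurable_auxPoint (β : ℝ) : Measurable (auxPoint β : V × V → V) := by
  unfold auxPoint
  fun_prop

theorem measurable_energy (β : ℝ) (wstar : V) : Measurable (energy β wstar) := by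
  have := measurable_auxPoint (V := V) β
  unfold energy
  fun_prop

theorem measurable_hbState {Ω E : Type*} [MeasurableSpace E] {g : E → V → V}
    (hg : Measurable (Function.uncurry g)) (a : ℕ → ℝ) (β : ℝ) (w₀ : V) (ζ : ℕ → Ω → E) (n : ℕ) :
    Measurable[pastσ ζ n] fun ω => hbState g a β w₀ (fun k => ζ k ω) n := by
  induction n with
  | zero => exact @measurable_const _ _ _ (pastσ ζ 0) _
  | succ n ih =>
    have hX := ih.mono (pastσ_mono (Nat.le_succ n)) le_rfl
    have hstep : Measurable fun q : (V × V) × E => hbStep β (a n) q.1 (g q.2 q.1.1) := by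
      have : Measurable fun q : (V × V) × E => g q.2 q.1.1 :=
        hg.comp (Measurable.prodMk (by fun_prop) (by fun_prop) :
          Measurable fun q : (V × V) × E => (q.2, q.1.1))
      unfold hbStep
      fun_prop
    exact hstep.comp (hX.prodMk (measurable_pastσ (Nat.lt_succ_self n)))

end Measurability

/-! ### Parameters, step sizes and weighted Lyapunov sums -/

/-- The admissible range of the constants. -/
structure IsParams (L β p c M : ℝ) : Prop where
  L_pos : 0 < L
  β_nonneg : 0 ≤ β
  β_lt : β < 1
  p_gt : 1 / 2 < p
  p_lt : p < 1
  c_pos : 0 < c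
  M_nonneg : 0 ≤ M

/-- Positive step sizes `a n ≤ c (n + 1)^{-p}`. -/
structure IsStepSeq (p c : ℝ) (a : ℕ → ℝ) : Prop where
  pos : ∀ n, 0 < a n
  le : ∀ n, a n ≤ c * ((n : ℝ) + 1) ^ (-p)

namespace IsStepSeq

variable {p c : ℝ} {a : ℕ → ℝ}

theorem le_const (ha : IsStepSeq p c a) (hc : 0 ≤ c) (hp : 0 ≤ p) (n : ℕ) : a n ≤ c := by
  refine (ha.le n).trans (mul_le_of_le_one_right hc ?_)
  exact Real.rpow_le_one_of_one_le_of_nonpos (by simp) (by linarith)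

theorem sq_le (ha : IsStepSeq p c a) (n : ℕ) :
    a n ^ 2 ≤ c ^ 2 * ((n : ℝ) + 1) ^ (-(1 + (2 * p - 1))) := by
  have h1 : a n ^ 2 ≤ (c * ((n : ℝ) + 1) ^ (-p)) ^ 2 :=
    pow_le_pow_left₀ (ha.pos n).le (ha.le n) 2
  have h2 : (((n : ℝ) + 1) ^ (-p)) ^ 2 = ((n : ℝ) + 1) ^ (-(1 + (2 * p - 1))) := by
    rw [← Real.rpow_natCast, ← Real.rpow_mul (by positivity)]
    congr 1; push_cast; ring
  rwa [mul_pow, h2] at h1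

theorem sum_sq_le (ha : IsStepSeq p c a) (hp : 1 / 2 < p) (hp1 : p < 1) (m n : ℕ) :
    ∑ k ∈ Finset.Ico m n, a k ^ 2 ≤
      c ^ 2 * (2 / (2 * p - 1)) * ((m : ℝ) + 1) ^ (-(2 * p - 1)) := by
  calc ∑ k ∈ Finset.Ico m n, a k ^ 2
      ≤ ∑ k ∈ Finset.Ico m n, c ^ 2 * ((k : ℝ) + 1) ^ (-(1 + (2 * p - 1))) :=
        Finset.sum_le_sum fun k _ => ha.sq_le k
    _ = c ^ 2 * ∑ k ∈ Finset.Ico m n, ((k : ℝ) + 1) ^ (-(1 + (2 * p - 1))) := by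
        rw [Finset.mul_sum]
    _ ≤ c ^ 2 * (2 / (2 * p - 1) * ((m : ℝ) + 1) ^ (-(2 * p - 1))) := by
        gcongr
        exact sum_Ico_rpow_neg_le (by linarith) (by linarith) m n
    _ = _ := by ring

theorem sum_sq_le_const (ha : IsStepSeq p c a) (hp : 1 / 2 < p) (hp1 : p < 1) (m n : ℕ) :
    ∑ k ∈ Finset.Ico m n, a k ^ 2 ≤ c ^ 2 * (2 / (2 * p - 1)) := by
  have h0 : 0 < 2 * p - 1 := by linarith
  refine (ha.sum_sq_le hp hp1 m n).trans (mul_le_of_le_one_right (by positivity) ?_)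
  exact Real.rpow_le_one_of_one_le_of_nonpos (by simp) (by linarith)

end IsStepSeq

/-- The index depends on p, c and s only, not on the sequence, so later constants are uniform over
step sizes. -/
theorem exists_small_steps {p c s : ℝ} (hp : 0 < p) (hs : 0 < s) :
    ∃ m : ℕ, ∀ a : ℕ → ℝ, IsStepSeq p c a → ∀ n, m ≤ n → a n ≤ s := by
  have h1 : Filter.Tendsto (fun n : ℕ => c * ((n : ℝ) + 1) ^ (-p)) Filter.atTop (nhds (c * 0)) :=
    ((tendsto_rpow_neg_atTop hp).comp
      (Filter.tendsto_atTop_add_const_right _ 1 tendsto_natCast_atTop_atTop)).const_mul c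
  rw [mul_zero] at h1
  obtain ⟨m, hm⟩ := Filter.eventually_atTop.1 (h1.eventually_le_const hs)
  exact ⟨m, fun a ha n hn => (ha.le n).trans (hm n hn)⟩

/-- Summation of a Lyapunov inequality with a multiplicative error, by means of slowly decreasing
weights. -/
theorem lyapunov_sum_le {v D f σ η : ℕ → ℝ} {m : ℕ} {η₀ S q e : ℝ} (hη₀ : 0 < η₀) (hS : 0 < S)
    (hv : ∀ n, 0 ≤ v n) (hσ : ∀ n, 0 ≤ σ n) (hσS : ∀ n, ∑ k ∈ Finset.Ico m n, σ k ≤ S)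
    (hη : ∀ n, η n = η₀ * (2 - (∑ k ∈ Finset.Ico m n, σ k) / S)) (he : 0 ≤ e)
    (hq : q ≤ η₀ / S)
    (hstep : ∀ n, m ≤ n → η (n + 1) * v (n + 1) ≤
      η (n + 1) * v n + f n - η₀ / 2 * D n + q * σ n * v n + η (n + 1) * e * σ n)
    (n : ℕ) (hn : m ≤ n) :
    η₀ * v n + η₀ / 2 * ∑ k ∈ Finset.Ico m n, D k ≤
      2 * η₀ * v m + ∑ k ∈ Finset.Ico m n, f k + 2 * η₀ * e * S := by
  have hle : ∀ n, η n ≤ 2 * η₀ := by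
    intro n
    have : 0 ≤ (∑ k ∈ Finset.Ico m n, σ k) / S :=
      div_nonneg (Finset.sum_nonneg fun k _ => hσ k) hS.le
    rw [hη]; nlinarith
  have hge : ∀ n, η₀ ≤ η n := by
    intro n
    have : (∑ k ∈ Finset.Ico m n, σ k) / S ≤ 1 := (div_le_one hS).2 (hσS n)
    rw [hη]; nlinarith
  have key : η n * v n + η₀ / 2 * ∑ k ∈ Finset.Ico m n, D k ≤
      2 * η₀ * v m + ∑ k ∈ Finset.Ico m n, f k + 2 * η₀ * e * ∑ k ∈ Finset.Ico m n, σ k := by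
    induction n, hn using Nat.le_induction with
    | base => simpa using mul_le_mul_of_nonneg_right (hle m) (hv m)
    | succ n hn ih =>
      have h1 := hstep n hn
      have h2 : η (n + 1) = η n - η₀ / S * σ n := by
        rw [hη, hη, Finset.sum_Ico_succ_top hn]; field_simp; ring
      have h3 : η (n + 1) * v n + q * σ n * v n ≤ η n * v n := by
        have : q * (σ n * v n) ≤ η₀ / S * (σ n * v n) :=
          mul_le_mul_of_nonneg_right hq (mul_nonneg (hσ n) (hv n))
        rw [h2]; linarith
      have h4 : η (n + 1) * e * σ n ≤ 2 * η₀ * e * σ n := by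
        have := mul_le_mul_of_nonneg_right (hle (n + 1)) (mul_nonneg he (hσ n))
        linarith
      rw [Finset.sum_Ico_succ_top hn, Finset.sum_Ico_succ_top hn, Finset.sum_Ico_succ_top hn]
      linarith
  have h1 := mul_le_mul_of_nonneg_right (hge n) (hv n)
  have h2 := mul_le_mul_of_nonneg_left (hσS n) (by positivity : 0 ≤ 2 * η₀ * e)
  linarith

/-! ### Pathwise growth of the energy -/

section Deterministic

variable {V : Type*} [NormedAddCommGroup V] [InnerProductSpace ℝ V] [MeasurableSpace V]
  {E : Type*} [MeasurableSpace E] {L M β p c : ℝ} {μ : Measure E} {ℓ : E → V → ℝ}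
  {g : E → V → V} {w₀ wstar : V} {a : ℕ → ℝ}

theorem sq_grad_le_of_energy (h : IsSmoothLoss L M μ ℓ g wstar) (hp : IsParams L β p c M) (z : E)
    (x : V × V) : ‖g z x.1‖ ^ 2 ≤ 4 * L * M + 4 * L ^ 2 * energy β wstar x := by
  have h1 := h.sq_grad_le_of_dist hp.L_pos z x.1
  have h2 := sq_dist_le_two_mul_energy hp.β_nonneg hp.β_lt wstar x
  nlinarith [sq_nonneg L]

theorem energy_hbStep_le_loss (h : IsSmoothLoss L M μ ℓ g wstar) (hp : IsParams L β p c M)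
    {α : ℝ} (hα : 0 ≤ α) (z : E) (x : V × V) :
    energy β wstar (hbStep β α x (g z x.1)) ≤ energy β wstar x
      - 2 * (α / (1 - β)) * (ℓ z x.1 - ℓ z wstar) + energyCoeff β * α ^ 2 * ‖g z x.1‖ ^ 2 := by
  have h1 : 0 < 1 - β := by linarith [hp.β_lt]
  refine (energy_hbStep_le hp.β_nonneg hp.β_lt α wstar x (g z x.1)).trans ?_
  have h2 := mul_le_mul_of_nonneg_left (h.sub_le_inner z x.1 wstar)
    (by positivity : 0 ≤ 2 * (α / (1 - β)))
  linarith

/-- The squared gradient is at most 2Lℓ(z, w), and ℓ(z, w) is the loss difference plus at most M.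
The first part merges with the first-order decrease, the second leaves a multiple of a². -/
theorem energy_hbStep_le_small (h : IsSmoothLoss L M μ ℓ g wstar) (hp : IsParams L β p c M)
    {α : ℝ} (hα : 0 ≤ α) (z : E) (x : V × V) :
    energy β wstar (hbStep β α x (g z x.1)) ≤ energy β wstar x
      - (2 * (α / (1 - β)) - 2 * L * energyCoeff β * α ^ 2) * (ℓ z x.1 - ℓ z wstar)
      + 2 * L * energyCoeff β * M * α ^ 2 := by
  have hB := energyCoeff_pos hp.β_lt
  have h1 := energy_hbStep_le_loss h hp hα z x
  have h2 := mul_le_mul_of_nonneg_left (h.sq_grad_le hp.L_pos z x.1)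
    (by positivity : 0 ≤ energyCoeff β * α ^ 2)
  have h3 := mul_le_mul_of_nonneg_left (h.le_bound z)
    (mul_nonneg (by positivity : 0 ≤ energyCoeff β * α ^ 2) hp.L_pos.le)
  linarith

/-- Growth factor of the energy per step, without any smallness of the step size. -/
noncomputable def growthFactor (L β c M : ℝ) : ℝ :=
  1 + 2 * (c / (1 - β)) * M + energyCoeff β * c ^ 2 * (4 * L * M + 4 * L ^ 2)

theorem one_le_growthFactor (hp : IsParams L β p c M) : 1 ≤ growthFactor L β c M := by
  have hB := energyCoeff_pos hp.β_lt
  have h1 : 0 < 1 - β := by linarith [hp.β_lt]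
  have hL := hp.L_pos
  have hM := hp.M_nonneg
  have hc := hp.c_pos
  unfold growthFactor
  have : 0 ≤ 2 * (c / (1 - β)) * M + energyCoeff β * c ^ 2 * (4 * L * M + 4 * L ^ 2) := by
    positivity
  linarith

/-- Exponential in n, hence used only for the finitely many steps before the step sizes become
small. -/
theorem energy_le_growth (h : IsSmoothLoss L M μ ℓ g wstar) (hp : IsParams L β p c M)
    (ha : IsStepSeq p c a) (z : ℕ → E) (n : ℕ) :
    1 + energy β wstar (hbState g a β w₀ z n) ≤
      growthFactor L β c M ^ n * (1 + ‖w₀ - wstar‖ ^ 2) := by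
  have hB := energyCoeff_pos hp.β_lt
  have h1 : 0 < 1 - β := by linarith [hp.β_lt]
  have hL := hp.L_pos
  have hM := hp.M_nonneg
  have hc := hp.c_pos
  have hQ := one_le_growthFactor hp
  induction n with
  | zero => simp [hbState, energy, auxPoint]
  | succ n ih =>
    set x := hbState g a β w₀ z n with hx
    have hac := ha.le_const hc.le (by linarith [hp.p_gt]) n
    have ha0 := (ha.pos n).le
    have h2 := energy_hbStep_le_loss h hp ha0 (z n) x
    have h3 := sq_grad_le_of_energy h hp (z n) x
    have h0 := energy_nonneg hp.β_lt wstar x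
    have h4 : -(2 * (a n / (1 - β)) * (ℓ (z n) x.1 - ℓ (z n) wstar)) ≤
        2 * (c / (1 - β)) * M := by
      have h5 : -(ℓ (z n) x.1 - ℓ (z n) wstar) ≤ M := by
        linarith [h.nonneg (z n) x.1, h.le_bound (z n)]
      calc _ = 2 * (a n / (1 - β)) * -(ℓ (z n) x.1 - ℓ (z n) wstar) := by ring
        _ ≤ 2 * (a n / (1 - β)) * M := by gcongr
        _ ≤ _ := by gcongr
    have h5 : energyCoeff β * a n ^ 2 * ‖g (z n) x.1‖ ^ 2 ≤
        energyCoeff β * c ^ 2 * (4 * L * M + 4 * L ^ 2 * energy β wstar x) := by gcongr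
    have h6 : energyCoeff β * c ^ 2 * (4 * L * M + 4 * L ^ 2 * energy β wstar x) ≤
        energyCoeff β * c ^ 2 * (4 * L * M + 4 * L ^ 2) * (1 + energy β wstar x) := by
      have : 4 * L * M + 4 * L ^ 2 * energy β wstar x ≤
          (4 * L * M + 4 * L ^ 2) * (1 + energy β wstar x) := by
        have : 0 ≤ 4 * L * M * energy β wstar x := by positivity
        nlinarith [sq_nonneg L]
      calc _ ≤ energyCoeff β * c ^ 2 * ((4 * L * M + 4 * L ^ 2) * (1 + energy β wstar x)) := by
            gcongr
        _ = _ := by ring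
    have h7 : 2 * (c / (1 - β)) * M ≤ 2 * (c / (1 - β)) * M * (1 + energy β wstar x) :=
      le_mul_of_one_le_right (by positivity) (by linarith)
    have h8 : 1 + energy β wstar (hbState g a β w₀ z (n + 1)) ≤
        growthFactor L β c M * (1 + energy β wstar x) := by
      change 1 + energy β wstar (hbStep β (a n) x (g (z n) x.1)) ≤ _
      unfold growthFactor
      linarith
    refine h8.trans ?_
    rw [pow_succ, mul_comm (growthFactor L β c M ^ n), mul_assoc]
    gcongr

/-- Deterministic a priori growth of the energy. -/
theorem exists_energy_growth_bound (hp : IsParams L β p c M) (w₀ wstar : V) :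
    ∃ (m : ℕ) (R C : ℝ), 0 ≤ R ∧ 0 < C ∧
      ∀ (E : Type) [MeasurableSpace E] (μ : Measure E) (ℓ : E → V → ℝ) (g : E → V → V)
        (a : ℕ → ℝ), IsSmoothLoss L M μ ℓ g wstar → IsStepSeq p c a →
        (∀ n, m ≤ n → 2 * L * energyCoeff β * a n ^ 2 ≤ a n / (1 - β)) ∧
        ∀ z : ℕ → E, (∀ n ≤ m, energy β wstar (hbState g a β w₀ z n) ≤ R) ∧
          ∀ n, energy β wstar (hbState g a β w₀ z n) ≤ C * ((n : ℝ) + 1) ^ (1 - p) := by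
  have hB := energyCoeff_pos hp.β_lt
  have h1 : 0 < 1 - β := by linarith [hp.β_lt]
  have hL := hp.L_pos
  have hM := hp.M_nonneg
  have hc := hp.c_pos
  have hQ := one_le_growthFactor hp
  have hp0 : 0 < p := by linarith [hp.p_gt]
  have hq : 0 < 1 - p := by linarith [hp.p_lt]
  obtain ⟨m, hm⟩ := exists_small_steps (p := p) (c := c)
    (s := 1 / (2 * L * energyCoeff β * (1 - β))) hp0 (by positivity)
  set R := growthFactor L β c M ^ m * (1 + ‖w₀ - wstar‖ ^ 2) with hR
  have hR0 : 0 < R := by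
    have : 0 < growthFactor L β c M := by linarith
    positivity
  -- Per late step: the loss difference is at least -M with coefficient at most 2a/(1-β), and the
  -- remainder is at most aM/(1-β).
  set K := 3 * M * c / (1 - β) with hK
  have hK0 : 0 ≤ K := by positivity
  refine ⟨m, R, R + K * (2 / (1 - p)), hR0.le, by positivity, ?_⟩
  intro E _ μ ℓ g a h ha
  have hsmall : ∀ n, m ≤ n → 2 * L * energyCoeff β * a n ^ 2 ≤ a n / (1 - β) := by
    intro n hn
    have h2 := hm a ha n hn
    have h3 := (ha.pos n).le
    rw [le_div_iff₀ (by positivity)] at h2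
    rw [le_div_iff₀ h1]
    nlinarith
  refine ⟨hsmall, fun z => ?_⟩
  have hearly : ∀ n ≤ m, energy β wstar (hbState g a β w₀ z n) ≤ R := by
    intro n hn
    have h2 := energy_le_growth (w₀ := w₀) h hp ha z n
    have h3 : growthFactor L β c M ^ n ≤ growthFactor L β c M ^ m := pow_le_pow_right₀ hQ hn
    have h4 := mul_le_mul_of_nonneg_right h3 (by positivity : 0 ≤ 1 + ‖w₀ - wstar‖ ^ 2)
    linarith
  refine ⟨hearly, ?_⟩
  have hsum : ∀ n, energy β wstar (hbState g a β w₀ z n) ≤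
      R + K * ∑ k ∈ Finset.range n, ((k : ℝ) + 1) ^ (-p) := by
    intro n
    rcases le_total n m with hn | hn
    · have : 0 ≤ K * ∑ k ∈ Finset.range n, ((k : ℝ) + 1) ^ (-p) := by positivity
      linarith [hearly n hn]
    induction n, hn using Nat.le_induction with
    | base =>
      have : 0 ≤ K * ∑ k ∈ Finset.range m, ((k : ℝ) + 1) ^ (-p) := by positivity
      linarith [hearly m le_rfl]
    | succ n hn ih =>
      set x := hbState g a β w₀ z n with hx
      have ha0 := (ha.pos n).le
      have h2 := energy_hbStep_le_small h hp ha0 (z n) x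
      have h3 := hsmall n hn
      have h4 : -(ℓ (z n) x.1 - ℓ (z n) wstar) ≤ M := by
        linarith [h.nonneg (z n) x.1, h.le_bound (z n)]
      have h5 : 0 ≤ 2 * (a n / (1 - β)) - 2 * L * energyCoeff β * a n ^ 2 := by
        have : 0 ≤ a n / (1 - β) := by positivity
        linarith
      have h6 := mul_le_mul_of_nonneg_left h4 h5
      have h7 : 0 ≤ 2 * L * energyCoeff β * a n ^ 2 := by positivity
      have h8 : a n / (1 - β) * M ≤ c * ((n : ℝ) + 1) ^ (-p) / (1 - β) * M := by
        gcongr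
        exact ha.le n
      have h9 : K * ((n : ℝ) + 1) ^ (-p) = 3 * (c * ((n : ℝ) + 1) ^ (-p) / (1 - β) * M) := by
        rw [hK]; ring
      rw [Finset.sum_range_succ, mul_add, h9]
      change energy β wstar (hbStep β (a n) x (g (z n) x.1)) ≤ _
      nlinarith [mul_le_mul_of_nonneg_right h3 hM]
  intro n
  have h2 := sum_range_rpow_neg_le hp0.le hp.p_lt n
  have h3 := mul_le_mul_of_nonneg_left h2 hK0
  have h4 : 1 ≤ ((n : ℝ) + 1) ^ (1 - p) := Real.one_le_rpow (by simp) hq.le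
  have h5 := mul_le_mul_of_nonneg_left h4 hR0.le
  linarith [hsum n]

end Deterministic

/-- Independent samples with common law `μ`. -/
structure IsSampleSeq {Ω E : Type*} [MeasurableSpace Ω] [MeasurableSpace E] (P : Measure Ω)
    (μ : Measure E) (ζ : ℕ → Ω → E) : Prop where
  measurable : ∀ n, Measurable (ζ n)
  indep : iIndepFun ζ P
  law : ∀ n, P.map (ζ n) = μ

/-! ### High-probability control of the energy -/

section Energy

variable {V : Type*} [NormedAddCommGroup V] [InnerProductSpace ℝ V] [MeasurableSpace V]

/-- The compensated increment of the energy supermartingale. -/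
noncomputable def energyIncr {E : Type*} [MeasurableSpace E] (L β M : ℝ) (μ : Measure E)
    (ℓ : E → V → ℝ) (wstar : V) (θ : ℝ) (x : V × V) (z : E) : ℝ :=
  -θ * (ℓ z x.1 - ℓ z wstar) -
    (-(θ * excess μ ℓ wstar x.1 / 2) + 8 * L * M * θ ^ 2 * energy β wstar x)

variable {E : Type*} [MeasurableSpace E] {L M β p c : ℝ} {μ : Measure E} {ℓ : E → V → ℝ}
  {g : E → V → V} {w₀ wstar : V} {a : ℕ → ℝ}

/-- With Y the loss difference, exp(-θY) ≤ 1 - θY + θ²Y² because θM ≤ 1, and Y² ≤ 4LV(Y + 2M). The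
condition 8LθV ≤ 1 lets half of the drift θ·E[Y] absorb the mean of 4LVθ²Y, leaving 8LMθ²V. -/
theorem lintegral_exp_energyIncr_le_one [IsProbabilityMeasure μ]
    (h : IsSmoothLoss L M μ ℓ g wstar) (hp : IsParams L β p c M) {θ : ℝ} (hθ : 0 ≤ θ)
    (hθM : θ * M ≤ 1) {x : V × V} (hθV : 8 * L * θ * energy β wstar x ≤ 1) :
    ∫⁻ z, ENNReal.ofReal (Real.exp (energyIncr L β M μ ℓ wstar θ x z)) ∂μ ≤ 1 := by
  have hL := hp.L_pos
  have hM := hp.M_nonneg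
  have hV := energy_nonneg hp.β_lt wstar x
  have hr := sq_dist_le_two_mul_energy hp.β_nonneg hp.β_lt wstar x
  set v := energy β wstar x with hv
  have hY : Integrable (fun z => ℓ z x.1 - ℓ z wstar) μ :=
    (h.integrable _).sub (h.integrable _)
  have hYi : ∫ z, (ℓ z x.1 - ℓ z wstar) ∂μ = excess μ ℓ wstar x.1 :=
    integral_sub (h.integrable _) (h.integrable _)
  have hA1 : Integrable (fun z => -θ * (ℓ z x.1 - ℓ z wstar)) μ := hY.const_mul _
  have hA2 : Integrable (fun z => θ ^ 2 * (4 * L * v) * (ℓ z x.1 - ℓ z wstar + 2 * M)) μ :=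
    (hY.add (integrable_const _)).const_mul _
  refine lintegral_exp_sub_le_one (A := fun z => -θ * (ℓ z x.1 - ℓ z wstar) +
    θ ^ 2 * (4 * L * v) * (ℓ z x.1 - ℓ z wstar + 2 * M)) ?_ (hA1.add hA2) ?_
  · intro z
    have h1 : -θ * (ℓ z x.1 - ℓ z wstar) ≤ 1 := by
      have : -(ℓ z x.1 - ℓ z wstar) ≤ M := by linarith [h.nonneg z x.1, h.le_bound z]
      nlinarith
    refine (exp_le_one_add_add_sq h1).trans ?_
    have h2 := h.sq_loss_sub_le hL hM z x.1
    have h3 : 0 ≤ ℓ z x.1 - ℓ z wstar + 2 * M := by linarith [h.nonneg z x.1, h.le_bound z]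
    have h4 : 2 * L * ‖x.1 - wstar‖ ^ 2 * (ℓ z x.1 - ℓ z wstar + 2 * M) ≤
        4 * L * v * (ℓ z x.1 - ℓ z wstar + 2 * M) := by
      gcongr ?_ * _
      nlinarith
    have h5 := mul_le_mul_of_nonneg_left (h2.trans h4) (sq_nonneg θ)
    linarith
  · rw [integral_add hA1 hA2, integral_const_mul, integral_const_mul,
      integral_add hY (integrable_const _), hYi]
    simp only [integral_const, probReal_univ, one_smul]
    have h1 := mul_le_mul_of_nonneg_right hθV (mul_nonneg hθ (h.excess_nonneg x.1))
    linarith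

theorem measurable_energyIncr [BorelSpace V] [SecondCountableTopology V] [IsProbabilityMeasure μ]
    (h : IsSmoothLoss L M μ ℓ g wstar) (θ : ℝ) :
    Measurable (Function.uncurry (energyIncr L β M μ ℓ wstar θ)) := by
  have h1 : Measurable fun q : (V × V) × E => ℓ q.2 q.1.1 :=
    h.measurable.comp (Measurable.prodMk (by fun_prop) (by fun_prop) :
      Measurable fun q : (V × V) × E => (q.2, q.1.1))
  have h2 : Measurable fun q : (V × V) × E => ℓ q.2 wstar :=
    h.measurable.comp (Measurable.prodMk (by fun_prop) (by fun_prop) :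
      Measurable fun q : (V × V) × E => (q.2, wstar))
  have h3 : Measurable (excess μ ℓ wstar) := h.measurable_excess
  have h4 := measurable_energy β wstar
  exact ((h1.sub h2).const_mul (-θ)).sub
    ((((h3.comp (measurable_fst.comp measurable_fst)).const_mul θ).div_const 2).neg.add
      ((h4.comp measurable_fst).const_mul (8 * L * M * θ ^ 2)))

variable [CompleteSpace V]

theorem excess_le_energy [IsProbabilityMeasure μ] (h : IsSmoothLoss L M μ ℓ g wstar)
    (hp : IsParams L β p c M) (x : V × V) :
    excess μ ℓ wstar x.1 ≤ L * energy β wstar x := by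
  have h1 := h.excess_le_sq_dist hp.L_pos x.1
  have h2 := sq_dist_le_two_mul_energy hp.β_nonneg hp.β_lt wstar x
  nlinarith [hp.L_pos]

/-- The energy and the accumulated excess risk are controlled pathwise by the compensated
increments. -/
theorem exists_energy_decomposition (hp : IsParams L β p c M) (w₀ wstar : V) :
    ∃ (m : ℕ) (K₁ K₂ : ℝ), 0 ≤ K₁ ∧ 0 < K₂ ∧
      ∀ (E : Type) [MeasurableSpace E] (μ : Measure E) [IsProbabilityMeasure μ] (ℓ : E → V → ℝ)
        (g : E → V → V) (a : ℕ → ℝ), IsSmoothLoss L M μ ℓ g wstar → IsStepSeq p c a →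
        ∃ θ : ℕ → ℝ, ∀ z : ℕ → E,
          (∀ n, m ≤ n → 0 ≤ θ n ∧ θ n * M ≤ 1 ∧
            8 * L * θ n * energy β wstar (hbState g a β w₀ z n) ≤ 1) ∧
          ∀ n, energy β wstar (hbState g a β w₀ z n) +
            ∑ k ∈ Finset.range n, a k * excess μ ℓ wstar (hbState g a β w₀ z k).1 ≤
            K₁ + K₂ * ∑ k ∈ Finset.Ico m n,
              energyIncr L β M μ ℓ wstar (θ k) (hbState g a β w₀ z k) (z k) := by
  have hB := energyCoeff_pos hp.β_lt
  have h1 : 0 < 1 - β := by linarith [hp.β_lt]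
  have hL := hp.L_pos
  have hM := hp.M_nonneg
  have hc := hp.c_pos
  have hp2 : 0 < 2 * p - 1 := by linarith [hp.p_gt]
  obtain ⟨m, R, C, hR, hC, hall⟩ := exists_energy_growth_bound hp w₀ wstar
  obtain ⟨S, hSdef⟩ : ∃ S, S = c ^ 2 * (2 / (2 * p - 1)) := ⟨_, rfl⟩
  have hS : 0 < S := by rw [hSdef]; positivity
  obtain ⟨e, hedef⟩ : ∃ e, e = 2 * L * energyCoeff β * M := ⟨_, rfl⟩
  have he : 0 ≤ e := by rw [hedef]; positivity
  -- The scale η₀ of the weights is chosen to make η₀Dᵢ ≤ 1: D₁ ensures θM ≤ 1, D₂ ensures 8LθV ≤ 1,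
  -- and D₃ lets the decrease of the weights absorb the compensator.
  obtain ⟨D₁, hD₁⟩ : ∃ D, D = 4 * (c / (1 - β)) * M := ⟨_, rfl⟩
  obtain ⟨D₂, hD₂⟩ : ∃ D, D = 32 * L / (1 - β) * (c * C) := ⟨_, rfl⟩
  obtain ⟨D₃, hD₃⟩ : ∃ D, D = 128 * L * M / (1 - β) ^ 2 * S := ⟨_, rfl⟩
  have hD₁0 : 0 ≤ D₁ := by rw [hD₁]; positivity
  have hD₂0 : 0 ≤ D₂ := by rw [hD₂]; positivity
  have hD₃0 : 0 ≤ D₃ := by rw [hD₃]; positivity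
  obtain ⟨η₀, hη₀def⟩ : ∃ η, η = 1 / (1 + D₁ + D₂ + D₃) := ⟨_, rfl⟩
  have hη₀ : 0 < η₀ := by rw [hη₀def]; positivity
  have hle1 : ∀ D, D ≤ 1 + D₁ + D₂ + D₃ → η₀ * D ≤ 1 := by
    intro D hD
    rw [hη₀def, one_div_mul_eq_div, div_le_one (by positivity)]
    exact hD
  have hηD₁ : η₀ * D₁ ≤ 1 := hle1 _ (by linarith)
  have hηD₂ : η₀ * D₂ ≤ 1 := hle1 _ (by linarith)
  have hηD₃ : η₀ * D₃ ≤ 1 := hle1 _ (by linarith)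
  refine ⟨m, 4 * R + 4 * e * S + m * (c * (L * R)), 2 / η₀, by positivity, by positivity, ?_⟩
  intro E _ μ _ ℓ g a h ha
  obtain ⟨hsmall, hpath⟩ := hall E μ ℓ g a h ha
  -- The weights decrease from 2η₀ but never below η₀, with decrements proportional to a².
  obtain ⟨η, hη⟩ : ∃ η : ℕ → ℝ, ∀ n, η n =
      η₀ * (2 - (∑ k ∈ Finset.Ico m n, a k ^ 2) / S) := ⟨_, fun _ => rfl⟩
  have hσS : ∀ n, ∑ k ∈ Finset.Ico m n, a k ^ 2 ≤ S := fun n => by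
    rw [hSdef]; exact ha.sum_sq_le_const hp.p_gt hp.p_lt m n
  have hηle : ∀ n, η n ≤ 2 * η₀ := by
    intro n
    have : 0 ≤ (∑ k ∈ Finset.Ico m n, a k ^ 2) / S := by positivity
    rw [hη]; nlinarith
  have hηge : ∀ n, η₀ ≤ η n := by
    intro n
    have : (∑ k ∈ Finset.Ico m n, a k ^ 2) / S ≤ 1 := (div_le_one hS).2 (hσS n)
    rw [hη]; nlinarith
  obtain ⟨b, hb⟩ : ∃ b : ℕ → ℝ, ∀ n, b n =
      2 * (a n / (1 - β)) - 2 * L * energyCoeff β * a n ^ 2 := ⟨_, fun _ => rfl⟩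
  have hble : ∀ n, b n ≤ 2 * (a n / (1 - β)) := by
    intro n
    have : 0 ≤ 2 * L * energyCoeff β * a n ^ 2 := by positivity
    rw [hb]; linarith
  have hbge : ∀ n, m ≤ n → a n ≤ b n := by
    intro n hn
    have h2 := hsmall n hn
    have h3 : a n ≤ a n / (1 - β) := by
      rw [le_div_iff₀ h1]
      nlinarith [ha.pos n, hp.β_nonneg]
    rw [hb]; linarith
  have hθle : ∀ n, m ≤ n → η (n + 1) * b n ≤ 4 * η₀ * (a n / (1 - β)) := by
    intro n hn
    have h2 := (ha.pos n).le.trans (hbge n hn)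
    have h3 := hηle (n + 1)
    calc η (n + 1) * b n ≤ (2 * η₀) * (2 * (a n / (1 - β))) := by
          gcongr
          exact hble n
      _ = _ := by ring
  have hθ0 : ∀ n, m ≤ n → η₀ * a n ≤ η (n + 1) * b n := by
    intro n hn
    have h2 := hbge n hn
    have h3 := hηge (n + 1)
    exact mul_le_mul h3 h2 (ha.pos n).le (hη₀.le.trans h3)
  -- The exponent θ is the weight times the coefficient of the loss difference; it is deterministic,
  -- the same for every sample path.
  refine ⟨fun n => η (n + 1) * b n, fun z => ?_⟩
  obtain ⟨hearly, hgrow⟩ := hpath z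
  have hθ0' : ∀ n, m ≤ n → 0 ≤ η (n + 1) * b n := fun n hn =>
    (mul_nonneg hη₀.le (ha.pos n).le).trans (hθ0 n hn)
  have hV0 : ∀ n, 0 ≤ energy β wstar (hbState g a β w₀ z n) := fun n =>
    energy_nonneg hp.β_lt _ _
  refine ⟨fun n hn => ⟨hθ0' n hn, ?_, ?_⟩, fun n => ?_⟩
  · have h2 := ha.le_const hc.le (by linarith) n
    calc η (n + 1) * b n * M ≤ 4 * η₀ * (a n / (1 - β)) * M :=
          mul_le_mul_of_nonneg_right (hθle n hn) hM
      _ ≤ 4 * η₀ * (c / (1 - β)) * M := by gcongr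
      _ = η₀ * D₁ := by rw [hD₁]; ring
      _ ≤ 1 := hηD₁
  -- Step size against a priori growth: the exponents add to 1 - 2p ≤ 0.
  · have h2 : a n * energy β wstar (hbState g a β w₀ z n) ≤ c * C := by
      calc a n * energy β wstar (hbState g a β w₀ z n)
          ≤ (c * ((n : ℝ) + 1) ^ (-p)) * (C * ((n : ℝ) + 1) ^ (1 - p)) := by
            gcongr
            · exact hV0 n
            · exact ha.le n
            · exact hgrow n
        _ = c * C * (((n : ℝ) + 1) ^ (-p) * ((n : ℝ) + 1) ^ (1 - p)) := by ring
        _ ≤ c * C * 1 := by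
            gcongr
            rw [← Real.rpow_add (by positivity)]
            exact Real.rpow_le_one_of_one_le_of_nonpos (by simp) (by linarith)
        _ = _ := mul_one _
    calc 8 * L * (η (n + 1) * b n) * energy β wstar (hbState g a β w₀ z n)
        ≤ 8 * L * (4 * η₀ * (a n / (1 - β))) * energy β wstar (hbState g a β w₀ z n) :=
          mul_le_mul_of_nonneg_right
            (mul_le_mul_of_nonneg_left (hθle n hn) (by positivity)) (hV0 n)
      _ = η₀ * (32 * L / (1 - β) * (a n * energy β wstar (hbState g a β w₀ z n))) := by ring
      _ ≤ η₀ * D₂ := by rw [hD₂]; gcongr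
      _ ≤ 1 := hηD₂
  have hterm : ∀ k ≤ m, a k * excess μ ℓ wstar (hbState g a β w₀ z k).1 ≤ c * (L * R) := by
    intro k hk
    have h2 := excess_le_energy h hp (hbState g a β w₀ z k)
    have h3 := hearly k hk
    have h4 := ha.le_const hc.le (by linarith) k
    have h5 := h.excess_nonneg (hbState g a β w₀ z k).1
    have h6 := (ha.pos k).le
    calc _ ≤ c * (L * energy β wstar (hbState g a β w₀ z k)) := by gcongr
      _ ≤ _ := by gcongr
  have hearlysum : ∀ n ≤ m, ∑ k ∈ Finset.range n,
      a k * excess μ ℓ wstar (hbState g a β w₀ z k).1 ≤ m * (c * (L * R)) := by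
    intro n hn
    calc _ ≤ ∑ k ∈ Finset.range n, c * (L * R) :=
          Finset.sum_le_sum fun k hk => hterm k ((Finset.mem_range.1 hk).le.trans hn)
      _ = n * (c * (L * R)) := by simp
      _ ≤ _ := by gcongr
  rcases le_total n m with hn | hn
  · rw [Finset.Ico_eq_empty_of_le hn, Finset.sum_empty, mul_zero, add_zero]
    have : 0 ≤ e * S := by positivity
    linarith [hearly n hn, hearlysum n hn]
  -- The value of q comes from θ ≤ 4η₀ a/(1-β), as 8·4² = 128.
  have hlyap := lyapunov_sum_le (v := fun n => energy β wstar (hbState g a β w₀ z n))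
    (D := fun k => a k * excess μ ℓ wstar (hbState g a β w₀ z k).1)
    (f := fun k => energyIncr L β M μ ℓ wstar (η (k + 1) * b k) (hbState g a β w₀ z k) (z k))
    (σ := fun k => a k ^ 2) (η := η) (m := m) (q := 128 * L * M * η₀ ^ 2 / (1 - β) ^ 2) (e := e)
    hη₀ hS hV0 (fun k => sq_nonneg _) hσS hη he
    (by
      rw [le_div_iff₀ hS]
      calc 128 * L * M * η₀ ^ 2 / (1 - β) ^ 2 * S = η₀ * (η₀ * D₃) := by rw [hD₃]; ring
        _ ≤ η₀ * 1 := by gcongr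
        _ = η₀ := mul_one _)
    (by
      intro k hk
      set x := hbState g a β w₀ z k with hx
      have h2 := energy_hbStep_le_small h hp (ha.pos k).le (z k) x
      rw [← hb, ← hedef] at h2
      have h3 := mul_le_mul_of_nonneg_left h2 (hη₀.le.trans (hηge (k + 1)))
      have h4 := mul_le_mul_of_nonneg_right (hθ0 k hk) (h.excess_nonneg x.1)
      have h5 : 8 * L * M * (η (k + 1) * b k) ^ 2 * energy β wstar x ≤
          128 * L * M * η₀ ^ 2 / (1 - β) ^ 2 * a k ^ 2 * energy β wstar x := by
        have h6 : (η (k + 1) * b k) ^ 2 ≤ (4 * η₀ * (a k / (1 - β))) ^ 2 :=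
          pow_le_pow_left₀ (hθ0' k hk) (hθle k hk) 2
        calc _ ≤ 8 * L * M * (4 * η₀ * (a k / (1 - β))) ^ 2 * energy β wstar x := by
              gcongr
              exact hV0 k
          _ = _ := by field_simp; ring
      change η (k + 1) * energy β wstar (hbStep β (a k) x (g (z k) x.1)) ≤ _
      unfold energyIncr
      linarith) n hn
  rw [← Finset.sum_range_add_sum_Ico _ hn]
  have h2 := hearlysum m le_rfl
  have h3 := hearly m le_rfl
  have h4 := hV0 n
  set s := ∑ k ∈ Finset.Ico m n,
    energyIncr L β M μ ℓ wstar (η (k + 1) * b k) (hbState g a β w₀ z k) (z k) with hs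
  set t := ∑ k ∈ Finset.Ico m n, a k * excess μ ℓ wstar (hbState g a β w₀ z k).1 with ht
  have h5 : energy β wstar (hbState g a β w₀ z n) + t ≤ 4 * R + 4 * e * S + 2 / η₀ * s := by
    have h6 : η₀ * (energy β wstar (hbState g a β w₀ z n) + t) ≤
        η₀ * (4 * R + 4 * e * S + 2 / η₀ * s) := by
      have e1 : η₀ * (2 / η₀ * s) = 2 * s := by field_simp
      have h7 := mul_le_mul_of_nonneg_left h3 hη₀.le
      have h8 := mul_nonneg hη₀.le h4
      rw [mul_add η₀ (4 * R + 4 * e * S), e1]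
      linarith
    exact le_of_mul_le_mul_left h6 hη₀
  linarith

theorem one_le_log_three_mul_div {T δ : ℝ} (hT : 1 ≤ T) (hδ : 0 < δ) (hδ1 : δ < 1) :
    1 ≤ Real.log (3 * T / δ) := by
  rw [Real.le_log_iff_exp_le (by positivity)]
  have h1 : Real.exp 1 ≤ 3 := by linarith [Real.exp_one_lt_d9]
  refine h1.trans ?_
  rw [le_div_iff₀ hδ]
  nlinarith

theorem exp_neg_log_three_mul_div {T δ : ℝ} (hT : 1 ≤ T) (hδ : 0 < δ) :
    Real.exp (-Real.log (3 * T / δ)) = δ / (3 * T) := by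
  rw [← Real.log_inv, Real.exp_log (by positivity), inv_div]

/-- With high probability, the energy and the accumulated excess risk stay logarithmic. -/
theorem exists_energy_tail_bound [BorelSpace V] [SecondCountableTopology V]
    (hp : IsParams L β p c M) (w₀ wstar : V) :
    ∃ C : ℝ, 0 < C ∧
      ∀ (E : Type) [MeasurableSpace E] (μ : Measure E) [IsProbabilityMeasure μ] (ℓ : E → V → ℝ)
        (g : E → V → V) (a : ℕ → ℝ) (Ω : Type*) [MeasurableSpace Ω] (P : Measure Ω)
        [IsProbabilityMeasure P] (ζ : ℕ → Ω → E),
        IsSmoothLoss L M μ ℓ g wstar → IsStepSeq p c a → IsSampleSeq P μ ζ →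
        ∀ (T : ℕ) (δ : ℝ), 1 ≤ T → 0 < δ → δ < 1 →
          P {ω | ∃ n ≤ T, C * Real.log (3 * T / δ) <
            energy β wstar (hbState g a β w₀ (fun k => ζ k ω) n) +
            ∑ k ∈ Finset.range n,
              a k * excess μ ℓ wstar (hbState g a β w₀ (fun k => ζ k ω) k).1} ≤
          ENNReal.ofReal (2 * δ / 3) := by
  obtain ⟨m, K₁, K₂, hK₁, hK₂, hall⟩ := exists_energy_decomposition hp w₀ wstar
  refine ⟨K₁ + K₂, by linarith, ?_⟩
  intro E _ μ _ ℓ g a Ω _ P _ ζ h ha hζ T δ hT hδ hδ1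
  obtain ⟨θ, hθ⟩ := hall E μ ℓ g a h ha
  have hT' : (1 : ℝ) ≤ T := by exact_mod_cast hT
  have hΛ := one_le_log_three_mul_div hT' hδ hδ1
  set Λ := Real.log (3 * T / δ) with hΛdef
  let X : ℕ → Ω → V × V := fun n ω => hbState g a β w₀ (fun k => ζ k ω) n
  let F : ℕ → Ω → ℝ := fun n ω => ∑ k ∈ Finset.Ico m n,
    energyIncr L β M μ ℓ wstar (θ k) (X k ω) (ζ k ω)
  -- At level Λ the Chernoff bound is δ/(3T); the union over the T + 1 ≤ 2T times costs 2δ/3.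
  have hF : ∀ n, P {ω | Λ ≤ F n ω} ≤ ENNReal.ofReal (δ / (3 * T)) := by
    intro n
    rw [← exp_neg_log_three_mul_div hT' hδ]
    refine measure_sum_ge_le_exp_neg (X := X)
      (f := fun k => energyIncr L β M μ ℓ wstar (θ k)) hζ.measurable hζ.indep hζ.law
      (fun n => measurable_hbState h.measurable_grad a β w₀ ζ n)
      (fun k => measurable_energyIncr h (θ k)) m n ?_ Λ
    intro k hk _ ω
    obtain ⟨h1, h2, h3⟩ := (hθ fun k => ζ k ω).1 k hk
    exact lintegral_exp_energyIncr_le_one h hp h1 h2 h3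
  calc _ ≤ P (⋃ n ∈ Finset.range (T + 1), {ω | Λ ≤ F n ω}) := by
        refine measure_mono ?_
        rintro ω ⟨n, hn, hω⟩
        refine Set.mem_biUnion (Finset.mem_coe.2 (Finset.mem_range.2 (Nat.lt_succ_of_le hn))) ?_
        have h1 := hω.trans_le ((hθ fun k => ζ k ω).2 n)
        have h2 : K₁ ≤ K₁ * Λ := le_mul_of_one_le_right hK₁ hΛ
        have h3 : K₂ * Λ ≤ K₂ * F n ω := by
          change _ < K₁ + K₂ * F n ω at h1
          linarith
        exact le_of_mul_le_mul_left h3 hK₂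
    _ ≤ ∑ n ∈ Finset.range (T + 1), P {ω | Λ ≤ F n ω} := measure_biUnion_finset_le _ _
    _ ≤ ∑ n ∈ Finset.range (T + 1), ENNReal.ofReal (δ / (3 * T)) :=
        Finset.sum_le_sum fun n _ => hF n
    _ = ENNReal.ofReal ((T + 1) * (δ / (3 * T))) := by
        rw [Finset.sum_const, Finset.card_range, nsmul_eq_mul, ENNReal.ofReal_mul (by positivity)]
        congr 1
        rw [← Nat.cast_succ, ENNReal.ofReal_natCast]
    _ ≤ ENNReal.ofReal (2 * δ / 3) := by
        refine ENNReal.ofReal_le_ofReal ?_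
        have : (T + 1 : ℝ) ≤ 2 * T := by linarith
        calc (T + 1 : ℝ) * (δ / (3 * T)) ≤ 2 * T * (δ / (3 * T)) := by gcongr
          _ = 2 * δ / 3 := by field_simp

end Energy

/-! ### Descent and noise along the auxiliary points -/

section LastIterate

variable {V : Type*} [NormedAddCommGroup V] [InnerProductSpace ℝ V] [MeasurableSpace V]

/-- The gradient noise along the auxiliary point, truncated to the region of energy at most `R`
and compensated. -/
noncomputable def noiseIncr {E : Type*} [MeasurableSpace E] (β R : ℝ) (μ : Measure E)
    (g : E → V → V) (wstar : V) (θ : ℝ) (x : V × V) (z : E) : ℝ :=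
  open Classical in
  if energy β wstar x ≤ R then
    -θ * inner ℝ (meanGrad μ g (auxPoint β x)) (g z x.1 - meanGrad μ g x.1)
      - θ / 2 * ‖meanGrad μ g (auxPoint β x)‖ ^ 2
  else 0

/-- A bound for all squared gradients and gradient noises in the region of energy at most `R`. -/
def gradBound (L M R : ℝ) : ℝ := 8 * L * M + 12 * L ^ 2 * R

variable {E : Type*} [MeasurableSpace E] {L M β p c R : ℝ} {μ : Measure E} {ℓ : E → V → ℝ}
  {g : E → V → V} {w₀ wstar : V} {a : ℕ → ℝ}

theorem sq_grad_le_gradBound (h : IsSmoothLoss L M μ ℓ g wstar) (hp : IsParams L β p c M)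
    {x : V × V} (hx : energy β wstar x ≤ R) (z : E) : ‖g z x.1‖ ^ 2 ≤ gradBound L M R := by
  have h1 := sq_grad_le_of_energy h hp z x
  have h0 := energy_nonneg hp.β_lt wstar x
  have h2 : 0 ≤ L * M := mul_nonneg hp.L_pos.le hp.M_nonneg
  have h3 : L ^ 2 * energy β wstar x ≤ L ^ 2 * R := by gcongr
  have h4 : 0 ≤ L ^ 2 * energy β wstar x := by positivity
  unfold gradBound
  linarith

section Complete

variable [CompleteSpace V] [IsProbabilityMeasure μ]

theorem sq_meanGrad_auxPoint_le (h : IsSmoothLoss L M μ ℓ g wstar) (hp : IsParams L β p c M)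
    {x : V × V} (hx : energy β wstar x ≤ R) :
    ‖meanGrad μ g (auxPoint β x)‖ ^ 2 ≤ gradBound L M R := by
  have h1 := h.norm_meanGrad_le hp.L_pos (auxPoint β x)
  have h2 := sq_auxPoint_sub_le_energy hp.β_lt wstar x
  have h3 : ‖meanGrad μ g (auxPoint β x)‖ ^ 2 ≤ (L * ‖auxPoint β x - wstar‖) ^ 2 := by gcongr
  have h4 : L ^ 2 * ‖auxPoint β x - wstar‖ ^ 2 ≤ L ^ 2 * R := by
    gcongr
    exact h2.trans hx
  have h5 : 0 ≤ L * M := mul_nonneg hp.L_pos.le hp.M_nonneg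
  have h6 : 0 ≤ L ^ 2 * ‖auxPoint β x - wstar‖ ^ 2 := by positivity
  unfold gradBound
  linarith

/-- Here ‖g‖² ≤ 4LM + 4L²V and ‖E g‖² ≤ 2L²V; doubling their sum gives the constants of `gradBound`.
-/
theorem sq_noise_le (h : IsSmoothLoss L M μ ℓ g wstar) (hp : IsParams L β p c M)
    {x : V × V} (hx : energy β wstar x ≤ R) (z : E) :
    ‖g z x.1 - meanGrad μ g x.1‖ ^ 2 ≤ gradBound L M R := by
  have h1 := sq_grad_le_of_energy h hp z x
  have h2 := h.norm_meanGrad_le hp.L_pos x.1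
  have h3 := sq_dist_le_two_mul_energy hp.β_nonneg hp.β_lt wstar x
  have h4 : ‖meanGrad μ g x.1‖ ^ 2 ≤ (L * ‖x.1 - wstar‖) ^ 2 := by gcongr
  have h5 : L ^ 2 * ‖x.1 - wstar‖ ^ 2 ≤ L ^ 2 * (2 * energy β wstar x) := by gcongr
  have h6 : ‖g z x.1 - meanGrad μ g x.1‖ ^ 2 ≤ (‖g z x.1‖ + ‖meanGrad μ g x.1‖) ^ 2 := by
    gcongr
    exact norm_sub_le _ _
  have h7 : L ^ 2 * energy β wstar x ≤ L ^ 2 * R := by gcongr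
  have h8 := sq_nonneg (‖g z x.1‖ - ‖meanGrad μ g x.1‖)
  unfold gradBound
  nlinarith

/-- The noise is centred, and its quadratic contribution θ²‖u‖²‖ξ‖² is at most θ‖u‖²/2 when θH ≤
1/2, which the compensator cancels. The truncation makes this hold at every state; on the good event
it is inactive. -/
theorem lintegral_exp_noiseIncr_le_one (h : IsSmoothLoss L M μ ℓ g wstar)
    (hp : IsParams L β p c M) {θ : ℝ} (hθ : 0 ≤ θ) (hθH : θ * gradBound L M R ≤ 1 / 2)
    (x : V × V) :
    ∫⁻ z, ENNReal.ofReal (Real.exp (noiseIncr β R μ g wstar θ x z)) ∂μ ≤ 1 := by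
  by_cases hx : energy β wstar x ≤ R
  swap
  · simp [noiseIncr, hx]
  simp only [noiseIncr, hx, if_true]
  set u := meanGrad μ g (auxPoint β x) with hu
  have hu2 : ‖u‖ ^ 2 ≤ gradBound L M R := sq_meanGrad_auxPoint_le h hp hx
  have hi : Integrable (fun z => g z x.1 - meanGrad μ g x.1) μ :=
    (h.integrable_grad x.1).sub (integrable_const _)
  have hX : Integrable (fun z => -θ * inner ℝ u (g z x.1 - meanGrad μ g x.1)) μ :=
    (hi.const_inner u).const_mul _
  refine lintegral_exp_sub_le_one (A := fun z => -θ * inner ℝ u (g z x.1 - meanGrad μ g x.1)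
    + θ / 2 * ‖u‖ ^ 2) ?_ (hX.add (integrable_const _)) ?_
  · intro z
    have h1 := sq_noise_le h hp hx z
    set ξ := g z x.1 - meanGrad μ g x.1 with hξ
    have h2 := abs_real_inner_le_norm u ξ
    have h3 : ‖u‖ * ‖ξ‖ ≤ gradBound L M R := by nlinarith [sq_nonneg (‖u‖ - ‖ξ‖)]
    have h4 : -θ * inner ℝ u ξ ≤ 1 := by
      have h5 : -inner ℝ u ξ ≤ gradBound L M R := (neg_le_abs _).trans (h2.trans h3)
      nlinarith
    refine (exp_le_one_add_add_sq h4).trans ?_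
    have h5 : (-θ * inner ℝ u ξ) ^ 2 ≤ θ / 2 * ‖u‖ ^ 2 := by
      have h6 : (inner ℝ u ξ) ^ 2 ≤ (‖u‖ * ‖ξ‖) ^ 2 := by
        rw [← sq_abs]; gcongr
      calc (-θ * inner ℝ u ξ) ^ 2 = θ ^ 2 * (inner ℝ u ξ) ^ 2 := by ring
        _ ≤ θ ^ 2 * (‖u‖ * ‖ξ‖) ^ 2 := by gcongr
        _ = θ ^ 2 * ‖u‖ ^ 2 * ‖ξ‖ ^ 2 := by ring
        _ ≤ θ ^ 2 * ‖u‖ ^ 2 * gradBound L M R := by gcongr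
        _ = θ * ‖u‖ ^ 2 * (θ * gradBound L M R) := by ring
        _ ≤ θ * ‖u‖ ^ 2 * (1 / 2) := by gcongr
        _ = _ := by ring
    linarith
  · rw [integral_add hX (integrable_const _), integral_const_mul, integral_inner hi,
      integral_sub (h.integrable_grad x.1) (integrable_const _)]
    simp [meanGrad]

theorem measurable_noiseIncr [BorelSpace V] [SecondCountableTopology V]
    (h : IsSmoothLoss L M μ ℓ g wstar) (θ : ℝ) :
    Measurable (Function.uncurry (noiseIncr β R μ g wstar θ)) := by
  have h1 : Measurable fun q : (V × V) × E => g q.2 q.1.1 :=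
    h.measurable_grad.comp (Measurable.prodMk (by fun_prop) (by fun_prop) :
      Measurable fun q : (V × V) × E => (q.2, q.1.1))
  have h3 : Measurable (meanGrad μ g) := by
    have : StronglyMeasurable fun w => ∫ z, g z w ∂μ :=
      h.measurable_grad.stronglyMeasurable.integral_prod_left
    exact this.measurable
  have h2 : Measurable fun q : (V × V) × E => meanGrad μ g (auxPoint β q.1) :=
    h3.comp ((measurable_auxPoint β).comp measurable_fst)
  have h4 := measurable_energy β wstar
  refine Measurable.ite (measurableSet_le (h4.comp measurable_fst) measurable_const) ?_
    measurable_const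
  exact ((h2.inner (h1.sub (h3.comp (measurable_fst.comp measurable_fst)))).const_mul (-θ)).sub
    ((h2.norm.pow_const 2).const_mul (θ / 2))

/-- Descent along the auxiliary points. -/
theorem excess_auxPoint_hbStep_le (h : IsSmoothLoss L M μ ℓ g wstar) (hp : IsParams L β p c M)
    {α : ℝ} (hα : 0 ≤ α) {x : V × V} (hx : energy β wstar x ≤ R) (z : E) :
    excess μ ℓ wstar (auxPoint β (hbStep β α x (g z x.1))) ≤ excess μ ℓ wstar (auxPoint β x)
      + noiseIncr β R μ g wstar (α / (1 - β)) x z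
      + (L ^ 2 * (β / (1 - β)) ^ 2 / 2 * (α / (1 - β)) * ‖x.2‖ ^ 2
        + L / 2 * (α / (1 - β)) ^ 2 * gradBound L M R) := by
  have h1 : 0 < 1 - β := by linarith [hp.β_lt]
  have hβ0 := hp.β_nonneg
  have hL := hp.L_pos
  simp only [noiseIncr, hx, if_true]
  set γ := α / (1 - β) with hγ
  have hγ0 : 0 ≤ γ := by positivity
  set y := auxPoint β x with hy
  set u := meanGrad μ g y with hu
  set v := meanGrad μ g x.1 with hv
  have h2 := h.excess_le_quadratic y (auxPoint β (hbStep β α x (g z x.1)))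
  have e1 : auxPoint β (hbStep β α x (g z x.1)) - y = -(γ • g z x.1) := by
    rw [auxPoint_hbStep hp.β_lt]; abel
  rw [e1, inner_neg_right, real_inner_smul_right, norm_neg, norm_smul, mul_pow,
    Real.norm_eq_abs, sq_abs] at h2
  have h3 : L / 2 * (γ ^ 2 * ‖g z x.1‖ ^ 2) ≤ L / 2 * (γ ^ 2 * gradBound L M R) := by
    gcongr
    exact sq_grad_le_gradBound h hp hx z
  have h4 : ‖u - v‖ ^ 2 ≤ L ^ 2 * (β / (1 - β)) ^ 2 * ‖x.2‖ ^ 2 := by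
    have h5 := h.meanGrad_lipschitz y x.1
    have e2 : y - x.1 = (β / (1 - β)) • x.2 := by rw [hy]; unfold auxPoint; abel
    rw [e2, norm_smul, Real.norm_of_nonneg (by positivity)] at h5
    calc ‖u - v‖ ^ 2 ≤ (L * (β / (1 - β) * ‖x.2‖)) ^ 2 := by gcongr
      _ = _ := by ring
  -- Polarization: -‖u‖²/2 becomes the compensator of the noise, and ‖u - v‖ is controlled by the
  -- velocity.
  have h5 : -inner ℝ u v ≤ ‖u - v‖ ^ 2 / 2 - ‖u‖ ^ 2 / 2 := by
    rw [norm_sub_sq_real]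
    linarith [sq_nonneg ‖v‖]
  have h6 : inner ℝ u (g z x.1) = inner ℝ u v + inner ℝ u (g z x.1 - v) := by
    rw [← inner_add_right, add_sub_cancel]
  have h7 := mul_le_mul_of_nonneg_left h5 hγ0
  have h8 := mul_le_mul_of_nonneg_left h4 hγ0
  rw [h6] at h2
  linarith

end Complete

/-- The compensator is linear in θ, so the weights of the summation by parts can be moved into θ. -/
theorem noiseIncr_smul (t θ : ℝ) (x : V × V) (z : E) :
    noiseIncr β R μ g wstar (t * θ) x z = t * noiseIncr β R μ g wstar θ x z := by
  unfold noiseIncr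
  split_ifs
  · ring
  · ring

/-- Summation by parts with increasing weights. -/
theorem weight_mul_le_sum {D γ ρ : ℕ → ℝ} {n₀ T : ℕ} (hγ : ∀ n, 0 ≤ γ n)
    (hstep : ∀ n, n₀ ≤ n → n < T → D (n + 1) ≤ D n + ρ n) (hT : n₀ ≤ T) :
    (∑ k ∈ Finset.Ico n₀ T, γ k) * D T ≤ ∑ k ∈ Finset.Ico n₀ T, γ k * D k +
      ∑ k ∈ Finset.Ico n₀ T, (∑ j ∈ Finset.Ico n₀ (k + 1), γ j) * ρ k := by
  induction T, hT using Nat.le_induction with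
  | base => simp
  | succ T hT ih =>
    have h1 := ih fun n hn hnT => hstep n hn (by omega)
    have h2 := mul_le_mul_of_nonneg_left (hstep T hT (by omega))
      (Finset.sum_nonneg fun k (_ : k ∈ Finset.Ico n₀ (T + 1)) => hγ k)
    rw [Finset.sum_Ico_succ_top hT (fun k => γ k * D k), Finset.sum_Ico_succ_top hT
      (fun k => (∑ j ∈ Finset.Ico n₀ (k + 1), γ j) * ρ k)]
    refine h2.trans ?_
    have h3 : (∑ k ∈ Finset.Ico n₀ (T + 1), γ k) * D T =
        (∑ k ∈ Finset.Ico n₀ T, γ k) * D T + γ T * D T := by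
      rw [Finset.sum_Ico_succ_top hT]; ring
    linarith

/-- Velocities stay small as long as the energy is bounded. -/
theorem exists_velocity_bound (hp : IsParams L β p c M) (w₀ wstar : V) :
    ∃ K : ℝ, 0 < K ∧ ∀ (E : Type) [MeasurableSpace E] (μ : Measure E) (ℓ : E → V → ℝ)
      (g : E → V → V) (a : ℕ → ℝ), IsSmoothLoss L M μ ℓ g wstar → IsStepSeq p c a →
      ∀ (z : ℕ → E) (R : ℝ) (T : ℕ), 0 ≤ R →
        (∀ n ≤ T, energy β wstar (hbState g a β w₀ z n) ≤ R) →
        (∀ n ≤ T, ‖(hbState g a β w₀ z n).2‖ ^ 2 ≤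
          K * gradBound L M R * ((n : ℝ) + 1) ^ (-(2 * p - 1))) ∧
        ∀ n₀ ≤ T, ∑ k ∈ Finset.Ico n₀ T, ‖(hbState g a β w₀ z k).2‖ ^ 2 ≤
          K * gradBound L M R * ((n₀ : ℝ) + 1) ^ (-(2 * p - 1)) := by
  have h1 : 0 < 1 - β := by linarith [hp.β_lt]
  have hp2 : 0 < 2 * p - 1 := by linarith [hp.p_gt]
  have hc := hp.c_pos
  obtain ⟨C, hC, hdamp⟩ := exists_le_rpow_neg_of_damped (q := 2 * p - 1) hp.β_nonneg hp.β_lt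
    hp2.le (by linarith [hp.p_lt])
  obtain ⟨K₁, hK₁⟩ : ∃ K, K = C * (c ^ 2 / (1 - β)) := ⟨_, rfl⟩
  obtain ⟨K₂, hK₂⟩ : ∃ K, K = (K₁ + c ^ 2 * (2 / (2 * p - 1)) / (1 - β)) / (1 - β) := ⟨_, rfl⟩
  have hK₁0 : 0 < K₁ := by rw [hK₁]; positivity
  have hK₂0 : 0 < K₂ := by rw [hK₂]; positivity
  refine ⟨K₁ + K₂, by positivity, ?_⟩
  intro E _ μ ℓ g a h ha z R T hR hV
  have hH : 0 ≤ gradBound L M R := by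
    have := hp.L_pos; have := hp.M_nonneg
    unfold gradBound; positivity
  set H := gradBound L M R with hHdef
  let u : ℕ → ℝ := fun n => ‖(hbState g a β w₀ z n).2‖ ^ 2
  have hrec : ∀ n < T, u (n + 1) ≤ β * u n + a n ^ 2 * (H / (1 - β)) := by
    intro n hn
    have h2 := sq_norm_velocity_hbStep_le hp.β_nonneg hp.β_lt (a n) (hbState g a β w₀ z n)
      (g (z n) (hbState g a β w₀ z n).1)
    refine h2.trans ?_
    have h3 : a n ^ 2 * ‖g (z n) (hbState g a β w₀ z n).1‖ ^ 2 / (1 - β) ≤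
        a n ^ 2 * H / (1 - β) := by
      gcongr
      exact sq_grad_le_gradBound h hp (hV n hn.le) (z n)
    rw [mul_div_assoc (a n ^ 2) H] at h3
    simp only [u]
    linarith
  have hpt : ∀ n ≤ T, u n ≤ K₁ * H * ((n : ℝ) + 1) ^ (-(2 * p - 1)) := by
    intro n hn
    have h2 := hdamp u (c ^ 2 * (H / (1 - β))) T (by positivity) (by simp [u, hbState]) (by
      intro n hn
      refine (hrec n hn).trans ?_
      have h3 : a n ^ 2 ≤ c ^ 2 * ((n : ℝ) + 1) ^ (-(2 * p - 1)) := by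
        refine (ha.sq_le n).trans ?_
        gcongr
        · simp
        · linarith
      have h4 := mul_le_mul_of_nonneg_right h3 (by positivity : 0 ≤ H / (1 - β))
      linarith) n hn
    refine h2.trans (le_of_eq ?_)
    rw [hK₁]; ring
  have hε : ∀ n : ℕ, 0 ≤ ((n : ℝ) + 1) ^ (-(2 * p - 1)) := fun n => by positivity
  refine ⟨fun n hn => (hpt n hn).trans ?_, fun n₀ hn₀ => ?_⟩
  · gcongr
    linarith
  -- Summing the recursion shows that the tail of squared velocities decays like the tail of squared
  -- steps, with no loss in the exponent.
  have hsum : ∀ n, n₀ ≤ n → n ≤ T → u n + (1 - β) * ∑ k ∈ Finset.Ico n₀ n, u k ≤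
      u n₀ + (∑ k ∈ Finset.Ico n₀ n, a k ^ 2) * (H / (1 - β)) := by
    intro n hn
    induction n, hn using Nat.le_induction with
    | base => simp
    | succ n hn ih =>
      intro hnT
      have h2 := ih (by omega)
      have h3 := hrec n (by omega)
      rw [Finset.sum_Ico_succ_top hn, Finset.sum_Ico_succ_top hn]
      linarith
  have h2 := hsum T hn₀ le_rfl
  have h3 := hpt n₀ hn₀
  have h4 := mul_le_mul_of_nonneg_right (ha.sum_sq_le hp.p_gt hp.p_lt n₀ T)
    (by positivity : 0 ≤ H / (1 - β))
  have h5 : 0 ≤ u T := by positivity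
  have h6 : (1 - β) * ∑ k ∈ Finset.Ico n₀ T, u k ≤
      (1 - β) * (K₂ * H * ((n₀ : ℝ) + 1) ^ (-(2 * p - 1))) := by
    have e : (1 - β) * (K₂ * H * ((n₀ : ℝ) + 1) ^ (-(2 * p - 1))) =
        K₁ * H * ((n₀ : ℝ) + 1) ^ (-(2 * p - 1)) + c ^ 2 * (2 / (2 * p - 1)) *
          ((n₀ : ℝ) + 1) ^ (-(2 * p - 1)) * (H / (1 - β)) := by
      rw [hK₂]
      field_simp
    rw [e]; linarith
  refine (le_of_mul_le_mul_left h6 h1).trans ?_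
  gcongr
  linarith

end LastIterate

/-! ### Tail bound for the last iterate -/

section LastIterateTail

variable {V : Type*} [NormedAddCommGroup V] [InnerProductSpace ℝ V] [MeasurableSpace V]
  {L M β p c : ℝ} {a : ℕ → ℝ}

/-- The partial sums of the effective step sizes. -/
noncomputable def stepSum (β : ℝ) (a : ℕ → ℝ) (n₀ n : ℕ) : ℝ :=
  ∑ j ∈ Finset.Ico n₀ n, a j / (1 - β)

/-- The normalization of the weighted noise for which exponential moments are available. -/
noncomputable def noiseScale (β p c : ℝ) (a : ℕ → ℝ) (n₀ T : ℕ) (H : ℝ) : ℝ :=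
  1 / (2 * stepSum β a n₀ T * (c * ((n₀ : ℝ) + 1) ^ (-p) / (1 - β)) * H)

theorem stepSum_nonneg (hp : IsParams L β p c M) (ha : IsStepSeq p c a) (n₀ n : ℕ) :
    0 ≤ stepSum β a n₀ n := by
  have h1 : 0 < 1 - β := by linarith [hp.β_lt]
  exact Finset.sum_nonneg fun k _ => div_nonneg (ha.pos k).le h1.le

theorem stepSum_pos (hp : IsParams L β p c M) (ha : IsStepSeq p c a) {n₀ n : ℕ} (hn : n₀ < n) :
    0 < stepSum β a n₀ n := by
  have h1 : 0 < 1 - β := by linarith [hp.β_lt]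
  exact Finset.sum_pos (fun k _ => div_pos (ha.pos k) h1) (Finset.nonempty_Ico.2 hn)

theorem stepSum_mono (hp : IsParams L β p c M) (ha : IsStepSeq p c a) (n₀ : ℕ) {n n' : ℕ}
    (hn : n ≤ n') : stepSum β a n₀ n ≤ stepSum β a n₀ n' := by
  have h1 : 0 < 1 - β := by linarith [hp.β_lt]
  exact Finset.sum_le_sum_of_subset_of_nonneg (Finset.Ico_subset_Ico_right hn)
    fun k _ _ => div_nonneg (ha.pos k).le h1.le

/-- Each partial step sum is at most the full one, and each step from n₀ on is at most c(n₀ +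
1)^(-p); the scale is the reciprocal of twice the resulting product. -/
theorem noiseScale_mul_le (hp : IsParams L β p c M) (ha : IsStepSeq p c a) {n₀ k T : ℕ}
    (hk : n₀ ≤ k) (hkT : k < T) {H : ℝ} (hH : 0 < H) :
    noiseScale β p c a n₀ T H * stepSum β a n₀ (k + 1) * (a k / (1 - β)) * H ≤ 1 / 2 := by
  have h1 : 0 < 1 - β := by linarith [hp.β_lt]
  have hc := hp.c_pos
  have hS := stepSum_pos hp ha (hk.trans_lt hkT)
  have hS2 := stepSum_mono hp ha n₀ (Nat.succ_le_of_lt hkT)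
  have hpow : 0 < c * ((n₀ : ℝ) + 1) ^ (-p) := by positivity
  have h2 : a k ≤ c * ((n₀ : ℝ) + 1) ^ (-p) := by
    refine (ha.le k).trans ?_
    refine mul_le_mul_of_nonneg_left ?_ hc.le
    refine Real.rpow_le_rpow_of_nonpos (by positivity) ?_ (by linarith [hp.p_gt])
    have : (n₀ : ℝ) ≤ k := by exact_mod_cast hk
    linarith
  unfold noiseScale
  set S := stepSum β a n₀ T
  set s := stepSum β a n₀ (k + 1)
  set A := c * ((n₀ : ℝ) + 1) ^ (-p) with hA
  have h3 : s * (a k / (1 - β)) ≤ S * (A / (1 - β)) := by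
    have := (ha.pos k).le
    gcongr
  have e : 1 / (2 * S * (A / (1 - β)) * H) * s * (a k / (1 - β)) * H =
      s * (a k / (1 - β)) / (S * (A / (1 - β))) / 2 := by
    field_simp
  rw [e]
  have h4 : s * (a k / (1 - β)) / (S * (A / (1 - β))) ≤ 1 :=
    (div_le_one (by positivity)).2 h3
  linarith

theorem noiseScale_pos (hp : IsParams L β p c M) (ha : IsStepSeq p c a) {n₀ T : ℕ} (hT : n₀ < T)
    {H : ℝ} (hH : 0 < H) : 0 < noiseScale β p c a n₀ T H := by
  have h1 : 0 < 1 - β := by linarith [hp.β_lt]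
  have hc := hp.c_pos
  have hS := stepSum_pos hp ha hT
  unfold noiseScale
  positivity

variable [CompleteSpace V]

set_option maxHeartbeats 1000000 in
/-- Pathwise bound for the last iterate in terms of the energy bound and the noise bound. -/
theorem exists_last_iterate_bound (hp : IsParams L β p c M) (w₀ wstar : V) {C : ℝ} (hC : 0 < C) :
    ∃ K : ℝ, 0 < K ∧ ∀ (E : Type) [MeasurableSpace E] (μ : Measure E) [IsProbabilityMeasure μ]
      (ℓ : E → V → ℝ) (g : E → V → V) (a : ℕ → ℝ), IsSmoothLoss L M μ ℓ g wstar →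
      IsStepSeq p c a → ∀ (z : ℕ → E) (Λ : ℝ) (n₀ T : ℕ), 1 ≤ Λ → n₀ < T →
      (∀ n ≤ T, energy β wstar (hbState g a β w₀ z n) + ∑ k ∈ Finset.range n,
        a k * excess μ ℓ wstar (hbState g a β w₀ z k).1 ≤ C * Λ) →
      ∑ k ∈ Finset.Ico n₀ T, noiseIncr β (C * Λ) μ g wstar
        (noiseScale β p c a n₀ T (gradBound L M (C * Λ)) * stepSum β a n₀ (k + 1) *
          (a k / (1 - β))) (hbState g a β w₀ z k) (z k) ≤ Λ →
      excess μ ℓ wstar (hbState g a β w₀ z T).1 ≤ K * Λ ^ 2 *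
        max (1 / ∑ k ∈ Finset.Ico n₀ T, a k) (((n₀ : ℝ) + 1) ^ (-(2 * p - 1))) := by
  have h1 : 0 < 1 - β := by linarith [hp.β_lt]
  have hp2 : 0 < 2 * p - 1 := by linarith [hp.p_gt]
  have hc := hp.c_pos
  have hL := hp.L_pos
  have hM := hp.M_nonneg
  have hβ0 := hp.β_nonneg
  obtain ⟨Kv, hKv, hvel⟩ := exists_velocity_bound hp w₀ wstar
  obtain ⟨h₀, hh₀⟩ : ∃ t, t = 8 * L * M + 12 * L ^ 2 * C := ⟨_, rfl⟩
  have hh₀0 : 0 < h₀ := by rw [hh₀]; positivity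
  obtain ⟨κ, hκ⟩ : ∃ t, t = β / (1 - β) := ⟨_, rfl⟩
  have hκ0 : 0 ≤ κ := by rw [hκ]; positivity
  -- A₁ bounds the weighted excess along auxiliary points, A₂ the noise, A₃ the descent errors, A₄
  -- the return from the auxiliary point to the iterate.
  obtain ⟨A₁, hA₁⟩ : ∃ t, t = 2 * C + L * κ ^ 2 * c * (Kv * h₀) := ⟨_, rfl⟩
  obtain ⟨A₂, hA₂⟩ : ∃ t, t = 2 * (c / (1 - β)) * h₀ := ⟨_, rfl⟩
  obtain ⟨A₃, hA₃⟩ : ∃ t, t = L ^ 2 * κ ^ 2 / 2 * (c / (1 - β)) * (Kv * h₀) +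
    L / 2 * (c ^ 2 * (2 / (2 * p - 1))) / (1 - β) ^ 2 * h₀ := ⟨_, rfl⟩
  obtain ⟨A₄, hA₄⟩ : ∃ t, t = L * κ ^ 2 * (Kv * h₀) := ⟨_, rfl⟩
  have hA₁0 : 0 < A₁ := by rw [hA₁]; positivity
  have hA₂0 : 0 < A₂ := by rw [hA₂]; positivity
  have hA₃0 : 0 < A₃ := by rw [hA₃]; positivity
  have hA₄0 : 0 ≤ A₄ := by rw [hA₄]; positivity
  refine ⟨2 * (A₁ + A₂ + A₃) + A₄, by positivity, ?_⟩
  intro E _ μ _ ℓ g a h ha z Λ n₀ T hΛ hT hgood hnoise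
  let x : ℕ → V × V := fun n => hbState g a β w₀ z n
  let γ : ℕ → ℝ := fun n => a n / (1 - β)
  have hγ0 : ∀ n, 0 ≤ γ n := fun n => div_nonneg (ha.pos n).le h1.le
  have hγc : ∀ n, γ n ≤ c / (1 - β) := fun n => by
    have := ha.le_const hc.le (by linarith [hp.p_gt]) n
    simp only [γ]; gcongr
  obtain ⟨R, hR⟩ : ∃ t, t = C * Λ := ⟨_, rfl⟩
  have hR0 : 0 < R := by rw [hR]; positivity
  rw [← hR] at hnoise
  obtain ⟨H, hH⟩ : ∃ t, t = gradBound L M R := ⟨_, rfl⟩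
  have hH0 : 0 < H := by rw [hH]; unfold gradBound; positivity
  have hHle : H ≤ h₀ * Λ := by
    rw [hH, hh₀, hR]; unfold gradBound
    nlinarith [mul_nonneg (mul_nonneg hL.le hM) (sub_nonneg.2 hΛ)]
  rw [← hH] at hnoise
  have hΔ0 : ∀ k, 0 ≤ excess μ ℓ wstar (x k).1 := fun k => h.excess_nonneg _
  have hV : ∀ n ≤ T, energy β wstar (x n) ≤ R := by
    intro n hn
    have h2 : 0 ≤ ∑ k ∈ Finset.range n, a k * excess μ ℓ wstar (x k).1 :=
      Finset.sum_nonneg fun k _ => mul_nonneg (ha.pos k).le (hΔ0 k)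
    rw [hR]
    linarith [hgood n hn]
  have hsumΔ : ∑ k ∈ Finset.Ico n₀ T, a k * excess μ ℓ wstar (x k).1 ≤ R := by
    have h2 := hgood T le_rfl
    have h3 := energy_nonneg hp.β_lt wstar (x T)
    have h4 : ∑ k ∈ Finset.Ico n₀ T, a k * excess μ ℓ wstar (x k).1 ≤
        ∑ k ∈ Finset.range T, a k * excess μ ℓ wstar (x k).1 := by
      refine Finset.sum_le_sum_of_subset_of_nonneg ?_
        fun k _ _ => mul_nonneg (ha.pos k).le (hΔ0 k)
      rw [Finset.range_eq_Ico]
      exact Finset.Ico_subset_Ico_left (Nat.zero_le _)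
    rw [hR]
    linarith
  obtain ⟨hv1, hv2⟩ := hvel E μ ℓ g a h ha z R T hR0.le hV
  rw [← hH] at hv1 hv2
  have hvT := hv1 T le_rfl
  have hvS := hv2 n₀ hT.le
  obtain ⟨ε, hε⟩ : ∃ t, t = ((n₀ : ℝ) + 1) ^ (-(2 * p - 1)) := ⟨_, rfl⟩
  rw [← hε] at hvS ⊢
  have hε0 : 0 < ε := by rw [hε]; positivity
  have hε1 : ε ≤ 1 := by
    rw [hε]; exact Real.rpow_le_one_of_one_le_of_nonpos (by simp) (by linarith)
  have hvT' : ‖(x T).2‖ ^ 2 ≤ Kv * H * ε := by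
    refine hvT.trans ?_
    have : ((T : ℝ) + 1) ^ (-(2 * p - 1)) ≤ ε := by
      rw [hε]
      refine Real.rpow_le_rpow_of_nonpos (by positivity) ?_ (by linarith)
      have : (n₀ : ℝ) ≤ T := by exact_mod_cast hT.le
      linarith
    gcongr
  obtain ⟨lam, hlam⟩ : ∃ t, t = noiseScale β p c a n₀ T H := ⟨_, rfl⟩
  have hlam0 : 0 < lam := by rw [hlam]; exact noiseScale_pos hp ha hT hH0
  obtain ⟨S, hS⟩ : ∃ t, t = stepSum β a n₀ T := ⟨_, rfl⟩
  have hS0 : 0 < S := by rw [hS]; exact stepSum_pos hp ha hT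
  have hSe : S = (∑ k ∈ Finset.Ico n₀ T, a k) / (1 - β) := by
    rw [hS, Finset.sum_div]; rfl
  let err : ℕ → ℝ := fun k => L ^ 2 * κ ^ 2 / 2 * γ k * ‖(x k).2‖ ^ 2 + L / 2 * γ k ^ 2 * H
  have herr0 : ∀ k, 0 ≤ err k := fun k => by
    have := hγ0 k
    simp only [err]; positivity
  let ν : ℕ → ℝ := fun k => noiseIncr β R μ g wstar (γ k) (x k) (z k)
  have hmain := weight_mul_le_sum (D := fun n => excess μ ℓ wstar (auxPoint β (x n))) (γ := γ)
    (ρ := fun k => ν k + err k) (n₀ := n₀) (T := T) hγ0 (by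
      intro n _ hn
      have h2 := excess_auxPoint_hbStep_le h hp (ha.pos n).le (hV n hn.le) (z n)
      rw [← hH, ← hκ] at h2
      simp only [ν, err]
      rw [← add_assoc]
      rw [← add_assoc] at h2
      rw [← add_assoc]
      exact h2) hT.le
  have hnoise' : ∑ k ∈ Finset.Ico n₀ T, (∑ j ∈ Finset.Ico n₀ (k + 1), γ j) * ν k ≤ Λ / lam := by
    rw [le_div_iff₀ hlam0, mul_comm, Finset.mul_sum]
    refine le_trans (le_of_eq (Finset.sum_congr rfl fun k _ => ?_)) hnoise
    rw [noiseIncr_smul, ← hlam]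
    simp only [stepSum, ν, γ, x]
    ring
  have herr : ∑ k ∈ Finset.Ico n₀ T, (∑ j ∈ Finset.Ico n₀ (k + 1), γ j) * err k ≤
      S * ∑ k ∈ Finset.Ico n₀ T, err k := by
    rw [Finset.mul_sum]
    refine Finset.sum_le_sum fun k hk => mul_le_mul_of_nonneg_right ?_ (herr0 k)
    rw [hS]
    exact stepSum_mono hp ha n₀ (Nat.succ_le_of_lt (Finset.mem_Ico.1 hk).2)
  have hγu : ∑ k ∈ Finset.Ico n₀ T, γ k * ‖(x k).2‖ ^ 2 ≤ c / (1 - β) * (Kv * H * ε) := by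
    calc _ ≤ ∑ k ∈ Finset.Ico n₀ T, c / (1 - β) * ‖(x k).2‖ ^ 2 :=
          Finset.sum_le_sum fun k _ => mul_le_mul_of_nonneg_right (hγc k) (sq_nonneg _)
      _ = c / (1 - β) * ∑ k ∈ Finset.Ico n₀ T, ‖(x k).2‖ ^ 2 := by rw [Finset.mul_sum]
      _ ≤ _ := mul_le_mul_of_nonneg_left hvS (by positivity)
  have hγsq : ∑ k ∈ Finset.Ico n₀ T, γ k ^ 2 ≤ c ^ 2 * (2 / (2 * p - 1)) * ε / (1 - β) ^ 2 := by
    have h2 := ha.sum_sq_le hp.p_gt hp.p_lt n₀ T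
    rw [← hε] at h2
    simp only [γ, div_pow]
    rw [← Finset.sum_div]
    gcongr
  have herrsum : ∑ k ∈ Finset.Ico n₀ T, err k ≤ A₃ * Λ * ε := by
    have h2 := mul_le_mul_of_nonneg_left hγu (by positivity : 0 ≤ L ^ 2 * κ ^ 2 / 2)
    have h3 := mul_le_mul_of_nonneg_left hγsq (by positivity : 0 ≤ L / 2 * H)
    have e1 : ∑ k ∈ Finset.Ico n₀ T, err k = L ^ 2 * κ ^ 2 / 2 *
        (∑ k ∈ Finset.Ico n₀ T, γ k * ‖(x k).2‖ ^ 2) +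
        L / 2 * H * ∑ k ∈ Finset.Ico n₀ T, γ k ^ 2 := by
      rw [Finset.mul_sum, Finset.mul_sum, ← Finset.sum_add_distrib]
      refine Finset.sum_congr rfl fun k _ => ?_
      simp only [err]; ring
    have e2 : A₃ * Λ * ε = L ^ 2 * κ ^ 2 / 2 * (c / (1 - β) * (Kv * (h₀ * Λ) * ε)) +
        L / 2 * (h₀ * Λ) * (c ^ 2 * (2 / (2 * p - 1)) * ε / (1 - β) ^ 2) := by
      rw [hA₃]; ring
    rw [e1, e2]
    refine (add_le_add h2 h3).trans ?_
    gcongr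
  -- One factor Λ is the tail level, the other comes from H ≤ h₀Λ; the power -p is weakened to 1 -
  -- 2p.
  have hlamΛ : Λ / lam ≤ S * (A₂ * Λ ^ 2 * ε) := by
    have h2 : ((n₀ : ℝ) + 1) ^ (-p) ≤ ε := by
      rw [hε]
      exact Real.rpow_le_rpow_of_exponent_le (by simp) (by linarith [hp.p_lt])
    have e1 : Λ / lam = S * (2 * (c * ((n₀ : ℝ) + 1) ^ (-p) / (1 - β)) * H * Λ) := by
      rw [hlam]; unfold noiseScale; rw [← hS]; field_simp
    rw [e1]
    have e2 : A₂ * Λ ^ 2 * ε = 2 * (c * ε / (1 - β)) * (h₀ * Λ) * Λ := by rw [hA₂]; ring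
    rw [e2]
    gcongr
  have hD : ∑ k ∈ Finset.Ico n₀ T, γ k * excess μ ℓ wstar (auxPoint β (x k)) ≤
      A₁ * Λ / (1 - β) := by
    have h2 : ∀ k, γ k * excess μ ℓ wstar (auxPoint β (x k)) ≤
        2 / (1 - β) * (a k * excess μ ℓ wstar (x k).1) +
          L * κ ^ 2 * (γ k * ‖(x k).2‖ ^ 2) := by
      intro k
      have h3 := h.excess_le_two_mul_excess hL (x k).1 (auxPoint β (x k))
      have e1 : auxPoint β (x k) - (x k).1 = κ • (x k).2 := by
        rw [hκ]; unfold auxPoint; abel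
      rw [e1, norm_smul, mul_pow, Real.norm_eq_abs, sq_abs] at h3
      have h4 := mul_le_mul_of_nonneg_left h3 (hγ0 k)
      refine h4.trans (le_of_eq ?_)
      simp only [γ]; ring
    calc _ ≤ ∑ k ∈ Finset.Ico n₀ T, (2 / (1 - β) * (a k * excess μ ℓ wstar (x k).1) +
          L * κ ^ 2 * (γ k * ‖(x k).2‖ ^ 2)) := Finset.sum_le_sum fun k _ => h2 k
      _ = 2 / (1 - β) * (∑ k ∈ Finset.Ico n₀ T, a k * excess μ ℓ wstar (x k).1) +
          L * κ ^ 2 * ∑ k ∈ Finset.Ico n₀ T, γ k * ‖(x k).2‖ ^ 2 := by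
          rw [Finset.sum_add_distrib, Finset.mul_sum, Finset.mul_sum]
      _ ≤ 2 / (1 - β) * (C * Λ) + L * κ ^ 2 * (c / (1 - β) * (Kv * (h₀ * Λ) * 1)) := by
          rw [← hR]
          refine add_le_add (mul_le_mul_of_nonneg_left hsumΔ (by positivity))
            (mul_le_mul_of_nonneg_left (hγu.trans ?_) (by positivity))
          gcongr
      _ = A₁ * Λ / (1 - β) := by rw [hA₁]; ring
  have hsplit : ∑ k ∈ Finset.Ico n₀ T, (∑ j ∈ Finset.Ico n₀ (k + 1), γ j) * (ν k + err k) =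
      ∑ k ∈ Finset.Ico n₀ T, (∑ j ∈ Finset.Ico n₀ (k + 1), γ j) * ν k +
      ∑ k ∈ Finset.Ico n₀ T, (∑ j ∈ Finset.Ico n₀ (k + 1), γ j) * err k := by
    rw [← Finset.sum_add_distrib]
    exact Finset.sum_congr rfl fun k _ => mul_add _ _ _
  obtain ⟨B, hB⟩ : ∃ t, t = max (1 / ∑ k ∈ Finset.Ico n₀ T, a k) ε := ⟨_, rfl⟩
  rw [← hB]
  have hBε : ε ≤ B := by rw [hB]; exact le_max_right _ _
  have hBa : 1 / ∑ k ∈ Finset.Ico n₀ T, a k ≤ B := by rw [hB]; exact le_max_left _ _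
  have hB0 : 0 < B := hε0.trans_le hBε
  have hΛ2 : Λ ≤ Λ ^ 2 := by nlinarith
  have hz : excess μ ℓ wstar (auxPoint β (x T)) ≤ (A₁ + A₂ + A₃) * Λ ^ 2 * B := by
    have h2 : A₁ * Λ / (1 - β) ≤ S * (A₁ * Λ ^ 2 * B) := by
      -- S is the sum of the a k divided by 1-β, so S times the first entry of the maximum is
      -- exactly 1/(1-β).
      have h3 : 1 / (1 - β) ≤ S * B := by
        calc 1 / (1 - β) = S * (1 / ∑ k ∈ Finset.Ico n₀ T, a k) := by
              have : 0 < ∑ k ∈ Finset.Ico n₀ T, a k :=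
                Finset.sum_pos (fun k _ => ha.pos k) (Finset.nonempty_Ico.2 hT)
              rw [hSe]; field_simp
          _ ≤ S * B := by gcongr
      calc A₁ * Λ / (1 - β) = A₁ * Λ * (1 / (1 - β)) := by ring
        _ ≤ A₁ * Λ ^ 2 * (S * B) := by gcongr
        _ = _ := by ring
    have h3 : S * (A₂ * Λ ^ 2 * ε) ≤ S * (A₂ * Λ ^ 2 * B) := by gcongr
    have h4 : S * ∑ k ∈ Finset.Ico n₀ T, err k ≤ S * (A₃ * Λ ^ 2 * B) := by
      have : A₃ * Λ * ε ≤ A₃ * Λ ^ 2 * B := by gcongr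
      exact mul_le_mul_of_nonneg_left (herrsum.trans this) hS0.le
    have h5 : S * excess μ ℓ wstar (auxPoint β (x T)) ≤ S * ((A₁ + A₂ + A₃) * Λ ^ 2 * B) := by
      have e1 : S = ∑ k ∈ Finset.Ico n₀ T, γ k := by rw [hS]; rfl
      rw [hsplit, ← e1] at hmain
      calc S * excess μ ℓ wstar (auxPoint β (x T))
          ≤ A₁ * Λ / (1 - β) + (Λ / lam + S * ∑ k ∈ Finset.Ico n₀ T, err k) :=
            hmain.trans (add_le_add hD (add_le_add hnoise' herr))
        _ ≤ S * (A₁ * Λ ^ 2 * B) + (S * (A₂ * Λ ^ 2 * B) + S * (A₃ * Λ ^ 2 * B)) :=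
            add_le_add h2 (add_le_add (hlamΛ.trans h3) h4)
        _ = _ := by ring
    exact le_of_mul_le_mul_left h5 hS0
  have hfin := h.excess_le_two_mul_excess hL (auxPoint β (x T)) (x T).1
  have e1 : (x T).1 - auxPoint β (x T) = -(κ • (x T).2) := by
    rw [hκ]; unfold auxPoint; abel
  rw [e1, norm_neg, norm_smul, mul_pow, Real.norm_eq_abs, sq_abs] at hfin
  have h6 : L * (κ ^ 2 * ‖(x T).2‖ ^ 2) ≤ A₄ * Λ ^ 2 * B := by
    calc L * (κ ^ 2 * ‖(x T).2‖ ^ 2) ≤ L * (κ ^ 2 * (Kv * (h₀ * Λ ^ 2) * B)) := by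
          gcongr
          refine hvT'.trans ?_
          gcongr
          exact hHle.trans (by gcongr)
      _ = _ := by rw [hA₄]; ring
  calc excess μ ℓ wstar (x T).1
      ≤ 2 * ((A₁ + A₂ + A₃) * Λ ^ 2 * B) + A₄ * Λ ^ 2 * B :=
        hfin.trans (add_le_add (mul_le_mul_of_nonneg_left hz zero_le_two) h6)
    _ = _ := by ring

/-- High-probability bound for the last heavy ball iterate. -/
theorem exists_excess_tail_bound [BorelSpace V] [SecondCountableTopology V]
    (hp : IsParams L β p c M) (w₀ wstar : V) :
    ∃ K : ℝ, 0 < K ∧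
      ∀ (E : Type) [MeasurableSpace E] (μ : Measure E) [IsProbabilityMeasure μ] (ℓ : E → V → ℝ)
        (g : E → V → V) (a : ℕ → ℝ) (Ω : Type*) [MeasurableSpace Ω] (P : Measure Ω)
        [IsProbabilityMeasure P] (ζ : ℕ → Ω → E),
        IsSmoothLoss L M μ ℓ g wstar → IsStepSeq p c a → IsSampleSeq P μ ζ →
        ∀ (n₀ T : ℕ) (δ : ℝ), n₀ < T → 0 < δ → δ < 1 →
          P {ω | K * Real.log (3 * T / δ) ^ 2 *
              max (1 / ∑ k ∈ Finset.Ico n₀ T, a k) (((n₀ : ℝ) + 1) ^ (-(2 * p - 1))) <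
            excess μ ℓ wstar (hbState g a β w₀ (fun k => ζ k ω) T).1} ≤ ENNReal.ofReal δ := by
  obtain ⟨C, hC, htail⟩ := exists_energy_tail_bound hp w₀ wstar
  obtain ⟨K, hK, hlast⟩ := exists_last_iterate_bound hp w₀ wstar hC
  refine ⟨K, hK, ?_⟩
  intro E _ μ _ ℓ g a Ω _ P _ ζ h ha hζ n₀ T δ hT hδ hδ1
  have hT1 : 1 ≤ T := Nat.one_le_of_lt hT
  have hT' : (1 : ℝ) ≤ T := by exact_mod_cast hT1
  have hΛ := one_le_log_three_mul_div hT' hδ hδ1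
  have h1 := htail E μ ℓ g a Ω P ζ h ha hζ T δ hT1 hδ hδ1
  have hexp := exp_neg_log_three_mul_div hT' hδ
  set Λ := Real.log (3 * T / δ) with hΛdef
  let X : ℕ → Ω → V × V := fun n ω => hbState g a β w₀ (fun k => ζ k ω) n
  let θ : ℕ → ℝ := fun k => noiseScale β p c a n₀ T (gradBound L M (C * Λ)) *
    stepSum β a n₀ (k + 1) * (a k / (1 - β))
  have hH : 0 < gradBound L M (C * Λ) := by
    have := hp.L_pos; have := hp.M_nonneg
    unfold gradBound; positivity
  have h2 : P {ω | Λ ≤ ∑ k ∈ Finset.Ico n₀ T,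
      noiseIncr β (C * Λ) μ g wstar (θ k) (X k ω) (ζ k ω)} ≤ ENNReal.ofReal (Real.exp (-Λ)) := by
    refine measure_sum_ge_le_exp_neg (X := X)
      (f := fun k => noiseIncr β (C * Λ) μ g wstar (θ k)) hζ.measurable hζ.indep hζ.law
      (fun n => measurable_hbState h.measurable_grad a β w₀ ζ n)
      (fun k => measurable_noiseIncr h (θ k)) n₀ T ?_ Λ
    intro k hk hkT ω
    refine lintegral_exp_noiseIncr_le_one h hp ?_ (noiseScale_mul_le hp ha hk hkT hH) _
    exact mul_nonneg (mul_nonneg (noiseScale_pos hp ha hT hH).le (stepSum_nonneg hp ha _ _))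
      (div_nonneg (ha.pos k).le (by linarith [hp.β_lt]))
  -- Off the energy and noise failures the pathwise bound applies; they cost 2δ/3 and δ/(3T) ≤ δ/3.
  refine (measure_mono (fun ω hω => ?_)).trans ((measure_union_le _ _).trans
    ((add_le_add h1 h2).trans ?_))
  · by_contra hcon
    rw [Set.mem_union, not_or] at hcon
    simp only [Set.mem_ofPred_eq, not_exists, not_and, not_lt, not_le] at hcon
    exact absurd (hlast E μ ℓ g a h ha (fun k => ζ k ω) Λ n₀ T hΛ hT hcon.1 hcon.2.le)
      (not_le.2 hω)
  · rw [hexp, ← ENNReal.ofReal_add (by positivity) (by positivity)]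
    refine ENNReal.ofReal_le_ofReal ?_
    have : δ / (3 * T) ≤ δ / 3 := by
      gcongr
      linarith
    linarith

end LastIterateTail

/-! ### Reduction to losses regular at every sample -/

section Reduction

/-- Each coordinate is a pointwise limit of difference quotients along a basis vector. -/
theorem measurable_gradient_param {E : Type*} [MeasurableSpace E] {d : ℕ} {f : E → Vec d → ℝ}
    (hf : ∀ w, Measurable fun z => f z w) (hd : ∀ z, Differentiable ℝ (f z)) (w : Vec d) :
    Measurable fun z => gradient (f z) w := by
  have hcoord : ∀ i, Measurable fun z => (gradient (f z) w) i := by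
    intro i
    let v : Vec d := EuclideanSpace.single i 1
    let s : ℕ → ℝ := fun n => 1 / ((n : ℝ) + 1)
    have hs : Filter.Tendsto s Filter.atTop (nhdsWithin 0 {0}ᶜ) :=
      tendsto_nhdsWithin_iff.2 ⟨tendsto_one_div_add_atTop_nhds_zero_nat,
        Filter.Eventually.of_forall fun n => by
          have : (0 : ℝ) < s n := by simp only [s]; positivity
          exact this.ne'⟩
    refine measurable_of_tendsto_metrizable (f := fun n z => (s n)⁻¹ * (f z (w + s n • v) - f z w))
      (fun n => ((hf _).sub (hf _)).const_mul _) ?_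
    rw [tendsto_pi_nhds]
    intro z
    have h1 := ((hasDerivAt_comp_line (hd z) w v 0).tendsto_slope_zero).comp hs
    simp only [zero_smul, add_zero, zero_add, smul_eq_mul] at h1
    have e : inner ℝ (gradient (f z) w) v = (gradient (f z) w) i := by
      rw [EuclideanSpace.inner_single_right]
      simp
    rw [e] at h1
    exact h1
  exact (MeasurableEquiv.toLp 2 (Fin d → ℝ)).measurable.comp (measurable_pi_iff.2 hcoord)

variable {N d : ℕ} {𝒵 : Set (Vec N)} {ρ : Vec N → ℝ} {ℓ : Vec N → Vec d → ℝ}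

open Classical in
/-- The loss, extended by zero outside the sample space. -/
noncomputable def extendLoss (𝒵 : Set (Vec N)) (ℓ : Vec N → Vec d → ℝ) (z : Vec N) : Vec d → ℝ :=
  if z ∈ 𝒵 then ℓ z else 0

theorem extendLoss_of_mem {z : Vec N} (hz : z ∈ 𝒵) : extendLoss 𝒵 ℓ z = ℓ z := by
  simp [extendLoss, hz]

theorem extendLoss_of_notMem {z : Vec N} (hz : z ∉ 𝒵) : extendLoss 𝒵 ℓ z = 0 := by
  simp [extendLoss, hz]

theorem gradient_extendLoss_of_notMem {z : Vec N} (hz : z ∉ 𝒵) (w : Vec d) :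
    gradient (extendLoss 𝒵 ℓ z) w = 0 := by
  rw [extendLoss_of_notMem hz]
  exact gradient_const w 0

theorem isProbabilityMeasure_sampleLaw (h : IsDensityOn 𝒵 ρ) :
    IsProbabilityMeasure (sampleLaw 𝒵 ρ) :=
  ⟨by rw [sampleLaw, withDensity_apply _ MeasurableSet.univ, Measure.restrict_univ, h.total]⟩

theorem sampleLaw_compl (h : IsDensityOn 𝒵 ρ) : sampleLaw 𝒵 ρ 𝒵ᶜ = 0 :=
  withDensity_absolutelyContinuous _ _ (by
    rw [Measure.restrict_apply h.measurableSet.compl]; simp)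

theorem ae_mem_sampleLaw (h : IsDensityOn 𝒵 ρ) : ∀ᵐ z ∂(sampleLaw 𝒵 ρ), z ∈ 𝒵 :=
  mem_ae_iff.2 (sampleLaw_compl h)

theorem integral_extendLoss (h : IsDensityOn 𝒵 ρ) (w : Vec d) :
    ∫ z, extendLoss 𝒵 ℓ z w ∂(sampleLaw 𝒵 ρ) = risk 𝒵 ρ ℓ w :=
  integral_congr_ae ((ae_mem_sampleLaw h).mono fun z hz => by simp only [extendLoss_of_mem hz])

/-- The zero loss has all the pointwise properties (M ≥ 0 for the last), and the sample law does not
charge the complement of 𝒵, so integrals are unchanged. -/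
theorem isSmoothLoss_extendLoss {L M : ℝ} {wstar : Vec d} (hL : 0 < L) (hM : 0 ≤ M)
    (hρ : IsDensityOn 𝒵 ρ) (h : LossAssumption L 𝒵 ρ ℓ wstar) (hb : ∀ z ∈ 𝒵, ℓ z wstar ≤ M) :
    IsSmoothLoss L M (sampleLaw 𝒵 ρ) (extendLoss 𝒵 ℓ)
      (fun z w => gradient (extendLoss 𝒵 ℓ z) w) wstar := by
  have hdiff : ∀ z, Differentiable ℝ (extendLoss 𝒵 ℓ z) := by
    intro z
    by_cases hz : z ∈ 𝒵
    · rw [extendLoss_of_mem hz]; exact h.differentiable z hz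
    · rw [extendLoss_of_notMem hz]; exact differentiable_const 0
  have hlip : ∀ z x y, ‖gradient (extendLoss 𝒵 ℓ z) x - gradient (extendLoss 𝒵 ℓ z) y‖ ≤
      L * ‖x - y‖ := by
    intro z x y
    by_cases hz : z ∈ 𝒵
    · rw [extendLoss_of_mem hz]; exact h.lipschitz_gradient z hz x y
    · rw [gradient_extendLoss_of_notMem hz, gradient_extendLoss_of_notMem hz, sub_zero, norm_zero]
      positivity
  have hmeas : ∀ w, Measurable fun z => extendLoss 𝒵 ℓ z w := by
    intro w
    classical
    have : (fun z => extendLoss 𝒵 ℓ z w) = fun z => if z ∈ 𝒵 then ℓ z w else 0 := by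
      ext z
      by_cases hz : z ∈ 𝒵 <;> simp [extendLoss, hz]
    rw [this]
    exact Measurable.ite hρ.measurableSet (h.measurable w) measurable_const
  have hcont : ∀ z, Continuous fun w => gradient (extendLoss 𝒵 ℓ z) w := fun z =>
    (LipschitzWith.of_dist_le_mul (K := ⟨L, hL.le⟩) fun x y => by
      rw [dist_eq_norm, dist_eq_norm]; exact hlip z x y).continuous
  refine ⟨?_, ?_, ?_, hlip, ?_, ?_, ?_, ?_, ?_, ?_⟩
  · intro z w
    by_cases hz : z ∈ 𝒵
    · rw [extendLoss_of_mem hz]; exact h.nonneg z hz w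
    · rw [extendLoss_of_notMem hz]; exact le_rfl
  · exact fun z x y => le_quadratic_of_lipschitz_gradient (hdiff z) (hlip z) x y
  · intro z x y
    refine sub_le_inner_gradient (hdiff z) ?_ x y
    by_cases hz : z ∈ 𝒵
    · rw [extendLoss_of_mem hz]; exact h.convex z hz
    · rw [extendLoss_of_notMem hz]; exact convexOn_const 0 convex_univ
  · exact (measurable_uncurry_of_continuous_of_measurable
      (u := fun w z => extendLoss 𝒵 ℓ z w) (fun z => (hdiff z).continuous) hmeas).comp
      measurable_swap
  · exact (measurable_uncurry_of_continuous_of_measurable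
      (u := fun w z => gradient (extendLoss 𝒵 ℓ z) w) hcont
      (measurable_gradient_param hmeas hdiff)).comp measurable_swap
  · intro w
    exact (h.integrable w).congr ((ae_mem_sampleLaw hρ).mono fun z hz => by
      simp only [extendLoss_of_mem hz])
  · intro w
    exact (h.integrable_gradient w).congr ((ae_mem_sampleLaw hρ).mono fun z hz => by
      simp only [extendLoss_of_mem hz])
  · intro w
    rw [integral_extendLoss hρ, integral_extendLoss hρ, h.minimizer]
    exact ciInf_le h.bddBelow w
  · intro z
    by_cases hz : z ∈ 𝒵
    · rw [extendLoss_of_mem hz]; exact hb z hz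
    · rw [extendLoss_of_notMem hz]; exact hM

theorem excess_extendLoss {L : ℝ} {wstar : Vec d} (hρ : IsDensityOn 𝒵 ρ)
    (h : LossAssumption L 𝒵 ρ ℓ wstar) (w : Vec d) :
    excess (sampleLaw 𝒵 ρ) (extendLoss 𝒵 ℓ) wstar w = risk 𝒵 ρ ℓ w - optValue 𝒵 ρ ℓ := by
  rw [excess, integral_extendLoss hρ, integral_extendLoss hρ, h.minimizer]

/-- Index shift: state n is the position at time n + 1 with the last displacement, which starts at
zero because w_1 = w_0. -/
theorem hbState_extendLoss {α : ℕ → ℝ} {β : ℝ} {w₀ : Vec d} {z : ℕ → Vec N}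
    (hz : ∀ t, z t ∈ 𝒵) (n : ℕ) :
    hbState (fun z w => gradient (extendLoss 𝒵 ℓ z) w) (fun k => α (k + 1)) β w₀
      (fun k => z (k + 1)) n =
      (heavyBall ℓ α β w₀ z (n + 1), heavyBall ℓ α β w₀ z (n + 1) - heavyBall ℓ α β w₀ z n) := by
  induction n with
  | zero => simp [hbState, heavyBall]
  | succ n ih =>
    rw [hbState, ih]
    simp only [extendLoss_of_mem (hz (n + 1)), hbStep, heavyBall]
    ext1 <;> simp only <;> abel

end Reduction

end SHB

theorem theoremt (d : ℕ) (L β p c₂ M : ℝ) (w₀ wstar : SHB.Vec d)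
    (hL : 0 < L) (hβ0 : 0 ≤ β) (hβ1 : β < 1) (hp : 1 / 2 < p) (hp1 : p < 1) :
    ∃ K : ℝ, 0 < K ∧
      ∀ (N : ℕ) (𝒵 : Set (SHB.Vec N)) (ρ : SHB.Vec N → ℝ) (ℓ : SHB.Vec N → SHB.Vec d → ℝ)
        (c₁ : ℝ) (α : ℕ → ℝ)
        (Ω : Type*) [MeasurableSpace Ω] (P : Measure Ω) [IsProbabilityMeasure P]
        (Z : ℕ → Ω → SHB.Vec N),
        SHB.IsDensityOn 𝒵 ρ →
        SHB.LossAssumption L 𝒵 ρ ℓ wstar →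
        (∀ z ∈ 𝒵, ℓ z wstar ≤ M) →
        0 < c₁ →
        SHB.StepSize p c₁ c₂ α →
        SHB.IsSample P 𝒵 ρ Z →
        ∀ (T T₀ : ℕ) (δ : ℝ), 1 < T → 1 < T₀ → T₀ ≤ T → 0 < δ → δ < 1 →
          ENNReal.ofReal (1 - δ) ≤
            P {ω | SHB.risk 𝒵 ρ ℓ (SHB.heavyBall ℓ α β w₀ (fun t => Z t ω) (T + 1))
                    - SHB.optValue 𝒵 ρ ℓ
                  ≤ K * (Real.log (3 * (T : ℝ) / δ)) ^ 2 *
                    max (1 / ∑ t ∈ Finset.Icc T₀ T, α t)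
                      (max ((T₀ : ℝ) ^ (1 - 2 * p)) (β ^ T₀))} := by
  -- Enlarging c₂ and M keeps the upper bounds valid and secures their signs.
  have hparams : SHB.IsParams L β p (max c₂ 1) (max M 0) :=
    ⟨hL, hβ0, hβ1, hp, hp1, lt_max_of_lt_right one_pos, le_max_right _ _⟩
  obtain ⟨K, hK, hmain⟩ := SHB.exists_excess_tail_bound hparams w₀ wstar
  refine ⟨K, hK, ?_⟩
  intro N 𝒵 ρ ℓ c₁ α Ω _ P _ Z hρ hℓ hb hc₁ hα hZ T T₀ δ hT hT₀ hTT δ0 δ1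
  have := SHB.isProbabilityMeasure_sampleLaw hρ
  have hloss := SHB.isSmoothLoss_extendLoss hL (le_max_right M 0) hρ hℓ
    fun z hz => (hb z hz).trans (le_max_left _ _)
  have hstep : SHB.IsStepSeq p (max c₂ 1) fun n => α (n + 1) := by
    refine ⟨fun n => lt_of_lt_of_le ?_ (hα.lower (n + 1) (by omega)), fun n => ?_⟩
    · positivity
    · refine (hα.upper (n + 1) (by omega)).trans ?_
      push_cast
      gcongr
      exact le_max_left _ _
  have hsample : SHB.IsSampleSeq P (SHB.sampleLaw 𝒵 ρ) fun n => Z (n + 1) :=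
    ⟨fun n => hZ.measurable _, hZ.indep.precomp (add_left_injective 1), fun n => hZ.law _⟩
  have hbad := hmain (SHB.Vec N) (SHB.sampleLaw 𝒵 ρ) (SHB.extendLoss 𝒵 ℓ) _ _ Ω P _ hloss hstep
    hsample (T₀ - 1) T δ (by omega) δ0 δ1
  have hmem : ∀ᵐ ω ∂P, ∀ t, Z t ω ∈ 𝒵 := by
    rw [ae_all_iff]
    intro t
    have h1 := SHB.ae_mem_sampleLaw hρ
    rw [← hZ.law t] at h1
    exact ae_of_ae_map (hZ.measurable t).aemeasurable h1
  have hnull : P {ω | ¬ ∀ t, Z t ω ∈ 𝒵} = 0 := hmem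
  have hcast : ((T₀ - 1 : ℕ) : ℝ) + 1 = T₀ := by
    rw [Nat.cast_sub hT₀.le]; simp
  have hsum : ∑ k ∈ Finset.Ico (T₀ - 1) T, α (k + 1) = ∑ t ∈ Finset.Icc T₀ T, α t := by
    rw [Finset.sum_Ico_add' α (T₀ - 1) T 1, Nat.sub_add_cancel hT₀.le]
    rfl
  rw [hcast, hsum, show -(2 * p - 1) = 1 - 2 * p by ring] at hbad
  set G := {ω | SHB.risk 𝒵 ρ ℓ (SHB.heavyBall ℓ α β w₀ (fun t => Z t ω) (T + 1))
    - SHB.optValue 𝒵 ρ ℓ ≤ K * (Real.log (3 * (T : ℝ) / δ)) ^ 2 *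
      max (1 / ∑ t ∈ Finset.Icc T₀ T, α t) (max ((T₀ : ℝ) ^ (1 - 2 * p)) (β ^ T₀))} with hG
  -- Covering the space by the good set, a null set and the bad set uses subadditivity only, so no
  -- measurability of the good set is needed.
  have hcover : (1 : ENNReal) ≤ P G + ENNReal.ofReal δ := by
    rw [← measure_univ (μ := P)]
    refine (measure_mono (fun ω _ => ?_)).trans ((measure_union_le G _).trans
      (add_le_add le_rfl ((measure_union_le _ _).trans
        ((add_le_add hnull.le hbad).trans (zero_add _).le))))
    by_cases hω : ∀ t, Z t ω ∈ 𝒵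
    swap
    · exact Or.inr (Or.inl hω)
    by_cases hωG : ω ∈ G
    · exact Or.inl hωG
    refine Or.inr (Or.inr ?_)
    have h1 := SHB.hbState_extendLoss (ℓ := ℓ) (α := α) (β := β) (w₀ := w₀)
      (z := fun t => Z t ω) hω T
    change _ < SHB.excess _ _ _ (SHB.hbState (fun z w => gradient (SHB.extendLoss 𝒵 ℓ z) w)
      (fun k => α (k + 1)) β w₀ (fun k => Z (k + 1) ω) T).1
    rw [h1, SHB.excess_extendLoss hρ hℓ]
    refine lt_of_le_of_lt ?_ (not_le.1 hωG)
    gcongr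
    -- The entry β^T₀ only enlarges the maximum.
    exact le_max_left _ _
  rw [ENNReal.ofReal_sub _ δ0.le, ENNReal.ofReal_one]
  exact tsub_le_iff_right.2 hcover
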